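/- **Setting.** Let $d\in\{2,3\}$ and let $\Omega\subset\mathbb R^d$ be bounded and open (for instance a bounded Lipschitz domain). Put $X=H^1_0(\Omega)^d$, $Y=H_0(\mathrm{div},\Omega)$, $E=S=L^2_0(\Omega)$, $Z=H^1_0(\Omega)$, where $H^1_0(\Omega)$ and $H_0(\mathrm{div},\Omega)$ are the closures of the smooth compactly supported functions, resp. vector fields, in the norms of $H^1(\Omega)$, resp. $H(\mathrm{div},\Omega)$. Let $(\cdot,\cdot)$, $\|\cdot\|_0$ be the inner product and norm of $L^2(\Omega)$, and $$\|K\|_{\rm div}^2=\|K\|_0^2+\|\nabla\cdot K\|_0^2,\qquad \|(w,K)\|_1^2=\|\nabla w\|_0^2+\|K\|_{\rm div}^2,\qquad \|(q,\psi)\|_0^2=\|q\|_0^2+\|\psi\|_0^2 .$$ There are constants $\lambda_1,\lambda_2,C_\Omega>0$, depending only on $\Omega$, with $$\|v\|_{L^6}\le\lambda_1\|\nabla v\|_0,\qquad \|v\|_{L^4}^2\le\lambda_2\|\nabla v\|_0^2,\qquad \|v\|_0\le C_\Omega\|\nabla v\|_0\qquad\text{for all } v\in X \text{ and all } v\in Z;$$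 let $\lambda_1,\lambda_2,C_\Omega$ be any such constants. Let $Pr>0$, $Ra\ge0$, $\kappa>0$, let $i\in\mathbb R^d$ be a unit vector, $B\in L^3(\Omega)^3$ (with $B=(0,0,B_3)$ if $d=2$), $f\in H^{-1}(\Omega)^d$, $g\in L^2(\Omega)^d$, $\varphi\in H^{-1}(\Omega)$. Vectors of $\mathbb R^2$ are read as vectors of $\mathbb R^3$ with third component $0$. For $\eta=(u,J)$, $\zeta=(w,M)$, $\Phi=(v,K)$ in $X\times Y$, $\chi=(q,\psi)\in E\times S$ and $\theta,r\in Z$ let $$\mathcal A_0(\eta,\Phi)=Pr(\nabla u,\nabla v)+\kappa(J,K)-\kappa(J\times B,v)+\kappa(K\times B,u),$$ $$\mathcal A_1(\zeta,\eta,\Phi)=\tfrac12((w\cdot\nabla)u,v)-\tfrac12((w\cdot\nabla)v,u),\qquad \mathcal H(\eta,\theta,r)=\tfrac12(u\cdot\nabla\theta,r)-\tfrac12(u\cdot\nabla r,\theta),$$ $$b_s(q,v)=-Pr(q,\nabla\cdot v),\quad b_m(\psi,K)=-\kappa(\psi,\nabla\cdot K),\quad \mathcal B(\chi,\Phi)=b_s(q,v)+b_m(\psi,K),$$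 $$\mathcal Q(\theta,\Phi)=-Pr\,Ra\,(\theta i,v),\quad e(\theta,r)=(\nabla\theta,\nabla r),\quad \langle L,\Phi\rangle=\langle f,v\rangle+\kappa(g,K),\quad \Psi(r)=\langle\varphi,r\rangle .$$ Further let $\|f\|_{-1}=\sup_{0\ne v\in X}\langle f,v\rangle/\|\nabla v\|_0$, $\|L\|_*=(\|f\|_{-1}^2+\kappa^2\|g\|_0^2)^{1/2}$, $\lambda_\psi=\sup_{0\ne r\in Z}\langle\varphi,r\rangle/\|\nabla r\|_0$, $\lambda_q=Pr\,Ra\,C_\Omega^2$, $C_{\min}=\min\{Pr,\kappa\}$, $C_{\max}=2\max\{Pr,\kappa,\kappa\lambda_1\|B\|_{L^3}\}$ and $$\sigma=\frac{\lambda_2\|L\|_*}{C_{\min}^2}+\frac{\lambda_2\lambda_q\lambda_\psi}{C_{\min}^2}+\frac{\lambda_2\lambda_q\lambda_\psi}{C_{\min}}+\frac{\lambda_2\|L\|_*}{C_{\min}} .$$ Let $X_h\subset X$, $E_h\subset E$, $Y_h\subset Y$, $S_h\subset S$, $Z_h\subset Z$ be finite-dimensional subspaces with $\nabla\cdot Y_h\subset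 S_h$ that satisfy, for some $\beta_{s,h},\beta_{m,h}>0$, the inf-sup conditions $$\sup_{0\ne v\in X_h}\frac{b_s(q,v)}{\|\nabla v\|_0\|q\|_0}\ge\beta_{s,h}\ \ (0\ne q\in E_h),\qquad \sup_{0\ne K\in Y_h}\frac{b_m(\psi,K)}{\|K\|_{\rm div}\|\psi\|_0}\ge\beta_{m,h}\ \ (0\ne\psi\in S_h),$$ and let $\beta^*=\min\{\beta_{s,h},\beta_{m,h}\}$, $D_h=X_h\times Y_h$, $G_h=E_h\times S_h$. The *discrete problem* is to find $(\eta_h,\xi_h,\theta_h)\in D_h\times G_h\times Z_h$ such that for all $(\Phi,\chi,r)\in D_h\times G_h\times Z_h$ $$\mathcal A_0(\eta_h,\Phi)+\mathcal A_1(\eta_h,\eta_h,\Phi)+\mathcal B(\xi_h,\Phi)+\mathcal Q(\theta_h,\Phi)=\langle L,\Phi\rangle,\quad \mathcal B(\chi,\eta_h)=0,\quad e(\theta_h,r)+\mathcal H(\eta_h,\theta_h,r)=\Psi(r).$$ The *Stokes iteration* (Method I) produces $(\eta_h^n,\xi_h^n,\theta_h^n)\in D_h\times G_h\times Z_h$,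 $n\ge0$, where for all $(\Phi,\chi,r)\in D_h\times G_h\times Z_h$ $$\mathcal A_0(\eta_h^0,\Phi)+\mathcal B(\xi_h^0,\Phi)+\mathcal Q(\theta_h^0,\Phi)=\langle L,\Phi\rangle,\quad \mathcal B(\chi,\eta_h^0)=0,\quad e(\theta_h^0,r)=\Psi(r),$$ and, for $n\ge1$, $$\mathcal A_0(\eta_h^n,\Phi)+\mathcal A_1(\eta_h^{n-1},\eta_h^{n-1},\Phi)+\mathcal B(\xi_h^n,\Phi)+\mathcal Q(\theta_h^n,\Phi)=\langle L,\Phi\rangle,\quad \mathcal B(\chi,\eta_h^n)=0,\quad e(\theta_h^n,r)+\mathcal H(\eta_h^{n-1},\theta_h^{n-1},r)=\Psi(r).$$ **Theorem 4.2 (Stokes Iteration).** Assume $0<\sigma<\tfrac14$. Then the discrete problem has exactly one solution $(\eta_h,\xi_h,\theta_h)$, the Stokes iteration is well defined (its iterates exist and are unique), and it is stable: for all $n\ge0$, $$\|\eta_h^n\|_1\le 2\,\frac{\|L\|_*+\lambda_q\lambda_\psi}{C_{\min}},\qquad \|\nabla\theta_h^n\|_0\le2\lambda_\psi .$$ Moreover,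 for all $n\ge0$, $$\|\eta_h-\eta_h^n\|_1\le(3\sigma)^n\,\frac{\|L\|_*+\lambda_q\lambda_\psi}{C_{\min}},\qquad \|\nabla(\theta_h-\theta_h^n)\|_0\le(3\sigma)^n\lambda_\psi,$$ $$\beta^*\,\|\xi_h-\xi_h^n\|_0\le (C_{\max}+2C_{\min})\,(3\sigma)^n\,\frac{\|L\|_*+\lambda_q\lambda_\psi}{C_{\min}} .$$ -/

import Mathlib

open MeasureTheory
open scoped ContDiff Matrix

noncomputable section

namespace ThermalMHD

/-- Points of `ℝ^d`, with the Euclidean norm. -/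
abbrev Pt (d : ℕ) := EuclideanSpace ℝ (Fin d)

variable {d : ℕ}

/-- Square integrable functions on `Ω` (with respect to Lebesgue measure) with values in `F`. -/
abbrev L2 (Ω : Set (Pt d)) (F : Type) [NormedAddCommGroup F] := Lp F 2 (volume.restrict Ω)

/-! ### Function spaces -/

/-- The pairs `(φ, ∇φ)` with `φ` a smooth scalar function with compact support in `Ω`. -/
def gradTest (Ω : Set (Pt d)) : Submodule ℝ (L2 Ω ℝ × L2 Ω (Pt d)) where
  carrier := {w | ∃ φ : Pt d → ℝ, ContDiff ℝ ∞ φ ∧ HasCompactSupport φ ∧ tsupport φ ⊆ Ω ∧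
    w.1 =ᵐ[volume.restrict Ω] φ ∧ w.2 =ᵐ[volume.restrict Ω] gradient φ}
  zero_mem' := by
    refine ⟨0, contDiff_const, HasCompactSupport.zero, by simp [tsupport], Lp.coeFn_zero _ _ _, ?_⟩
    filter_upwards [Lp.coeFn_zero (Pt d) 2 (volume.restrict Ω)] with x hx
    have h : gradient (0 : Pt d → ℝ) x = 0 := gradient_fun_const x 0
    rw [h]
    exact hx
  add_mem' := by
    rintro a b ⟨φ, h1, h2, h3, h4, h5⟩ ⟨ψ, k1, k2, k3, k4, k5⟩
    refine ⟨φ + ψ, h1.add k1, h2.add k2,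
      (tsupport_add φ ψ).trans (Set.union_subset h3 k3), ?_, ?_⟩
    · filter_upwards [Lp.coeFn_add a.1 b.1, h4, k4] with x e1 e2 e3
      simp only [Prod.fst_add, e1, Pi.add_apply, e2, e3]
    · filter_upwards [Lp.coeFn_add a.2 b.2, h5, k5] with x e1 e2 e3
      have hφ : DifferentiableAt ℝ φ x := (h1.differentiable (by simp)) x
      have hψ : DifferentiableAt ℝ ψ x := (k1.differentiable (by simp)) x
      simp only [Prod.snd_add, e1, Pi.add_apply, e2, e3, gradient, fderiv_add hφ hψ, map_add]
  smul_mem' := by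
    rintro c a ⟨φ, h1, h2, h3, h4, h5⟩
    refine ⟨c • φ, contDiff_const.smul h1, h2.smul_left (f := fun _ => c),
      (tsupport_smul_subset_right (fun _ => c) φ).trans h3, ?_, ?_⟩
    · filter_upwards [Lp.coeFn_smul c a.1, h4] with x e1 e2
      simp [e1, e2]
    · filter_upwards [Lp.coeFn_smul c a.2, h5] with x e1 e2
      have hφ : DifferentiableAt ℝ φ x := (h1.differentiable (by simp)) x
      simp only [Prod.smul_snd, e1, Pi.smul_apply, e2, gradient, fderiv_const_smul hφ, map_smul]

/-- `H^1_0(Ω)`: the closure of the smooth compactly supported functions in the `H^1` norm. An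
element is stored together with its weak gradient, as a pair `(v, ∇v)` in `L^2 × L^2`. -/
def H10 (Ω : Set (Pt d)) : Submodule ℝ (L2 Ω ℝ × L2 Ω (Pt d)) := (gradTest Ω).topologicalClosure

/-- The underlying function of an element of `H^1_0(Ω)`. -/
def fnOf {Ω : Set (Pt d)} (v : H10 Ω) : L2 Ω ℝ := v.1.1

/-- The weak gradient of an element of `H^1_0(Ω)`. -/
def gradOf {Ω : Set (Pt d)} (v : H10 Ω) : L2 Ω (Pt d) := v.1.2

/-- The classical divergence of a vector field. -/
def divergence (φ : Pt d → Pt d) (x : Pt d) : ℝ :=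
  ∑ i, (fderiv ℝ φ x (EuclideanSpace.single i 1)) i

/-- The pairs `(φ, ∇ · φ)` with `φ` a smooth vector field with compact support in `Ω`. -/
def divTest (Ω : Set (Pt d)) : Submodule ℝ (L2 Ω (Pt d) × L2 Ω ℝ) where
  carrier := {w | ∃ φ : Pt d → Pt d, ContDiff ℝ ∞ φ ∧ HasCompactSupport φ ∧ tsupport φ ⊆ Ω ∧
    w.1 =ᵐ[volume.restrict Ω] φ ∧ w.2 =ᵐ[volume.restrict Ω] divergence φ}
  zero_mem' := by
    refine ⟨0, contDiff_const, HasCompactSupport.zero, by simp [tsupport], Lp.coeFn_zero _ _ _, ?_⟩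
    filter_upwards [Lp.coeFn_zero ℝ 2 (volume.restrict Ω)] with x hx
    have h : divergence (0 : Pt d → Pt d) x = 0 := by simp [divergence]
    rw [h]
    exact hx
  add_mem' := by
    rintro a b ⟨φ, h1, h2, h3, h4, h5⟩ ⟨ψ, k1, k2, k3, k4, k5⟩
    refine ⟨φ + ψ, h1.add k1, h2.add k2,
      (tsupport_add φ ψ).trans (Set.union_subset h3 k3), ?_, ?_⟩
    · filter_upwards [Lp.coeFn_add a.1 b.1, h4, k4] with x e1 e2 e3
      simp only [Prod.fst_add, e1, Pi.add_apply, e2, e3]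
    · filter_upwards [Lp.coeFn_add a.2 b.2, h5, k5] with x e1 e2 e3
      have hφ : DifferentiableAt ℝ φ x := (h1.differentiable (by simp)) x
      have hψ : DifferentiableAt ℝ ψ x := (k1.differentiable (by simp)) x
      rw [Prod.snd_add, e1, Pi.add_apply, e2, e3]
      simp [divergence, fderiv_add hφ hψ, Finset.sum_add_distrib]
  smul_mem' := by
    rintro c a ⟨φ, h1, h2, h3, h4, h5⟩
    refine ⟨c • φ, contDiff_const.smul h1, h2.smul_left (f := fun _ => c),
      (tsupport_smul_subset_right (fun _ => c) φ).trans h3, ?_, ?_⟩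
    · filter_upwards [Lp.coeFn_smul c a.1, h4] with x e1 e2
      simp [e1, e2]
    · filter_upwards [Lp.coeFn_smul c a.2, h5] with x e1 e2
      have hφ : DifferentiableAt ℝ φ x := (h1.differentiable (by simp)) x
      simp [e1, e2, divergence, fderiv_const_smul hφ, Finset.mul_sum]

/-- `H_0(div, Ω)`: the closure of the smooth compactly supported vector fields in the norm of
`H(div, Ω)`, that is, the fields in `H(div, Ω)` whose normal component vanishes on the boundary.
An element is stored together with its weak divergence, as a pair `(K, ∇ · K)`. -/
def H0div (Ω : Set (Pt d)) : Submodule ℝ (L2 Ω (Pt d) × L2 Ω ℝ) := (divTest Ω).topologicalClosure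

/-- The underlying vector field of an element of `H_0(div, Ω)`. -/
def fieldOf {Ω : Set (Pt d)} (K : H0div Ω) : L2 Ω (Pt d) := K.1.1

/-- The weak divergence of an element of `H_0(div, Ω)`. -/
def divOf {Ω : Set (Pt d)} (K : H0div Ω) : L2 Ω ℝ := K.1.2

/-- `L^2_0(Ω)`: the functions in `L^2(Ω)` with integral zero. (Integrability is automatic when `Ω`
is bounded.) -/
def L20 (Ω : Set (Pt d)) : Submodule ℝ (L2 Ω ℝ) where
  carrier := {q | Integrable q (volume.restrict Ω) ∧ ∫ x in Ω, q x = 0}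
  zero_mem' := by
    have h := Lp.coeFn_zero ℝ 2 (volume.restrict Ω)
    refine ⟨(integrable_zero _ _ _).congr h.symm, ?_⟩
    rw [integral_congr_ae h]
    simp
  add_mem' := by
    rintro a b ⟨ia, ha⟩ ⟨ib, hb⟩
    have h := Lp.coeFn_add a b
    refine ⟨(ia.add ib).congr h.symm, ?_⟩
    rw [integral_congr_ae h]
    simp only [Pi.add_apply]
    rw [integral_add ia ib, ha, hb, add_zero]
  smul_mem' := by
    rintro c a ⟨ia, ha⟩
    have h := Lp.coeFn_smul c a
    refine ⟨(ia.smul c).congr h.symm, ?_⟩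
    rw [integral_congr_ae h]
    simp only [Pi.smul_apply, integral_smul, ha, smul_zero]

/-- The velocity space `X = H^1_0(Ω)^d`. -/
abbrev Vel (Ω : Set (Pt d)) := Fin d → H10 Ω

/-- The space `D = X × Y` of pairs (velocity, current density). -/
abbrev VelCur (Ω : Set (Pt d)) := Vel Ω × H0div Ω

/-- The space `G = E × S` of pairs (pressure, electric potential). -/
abbrev PrePot (Ω : Set (Pt d)) := L20 Ω × L20 Ω

variable {Ω : Set (Pt d)}

/-- The velocity as a vector field. -/
def velFn (v : Vel Ω) (x : Pt d) : Pt d := WithLp.toLp 2 fun i => fnOf (v i) x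

/-- The weak divergence `∇ · v = ∑ ∂_i v_i` of a velocity. -/
def velDiv (v : Vel Ω) (x : Pt d) : ℝ := ∑ i, (gradOf (v i) x) i

/-- `(a · ∇) v = (a · ∇ v_i)_i` for a velocity `v` and a vector field `a`. -/
def convect (a : Pt d → Pt d) (v : Vel Ω) (x : Pt d) : Pt d :=
  WithLp.toLp 2 fun i => inner ℝ (a x) (gradOf (v i) x)

/-! ### Norms -/

/-- `‖∇v‖_0` for a velocity `v`, the root of the sum of the squares of the `‖∇v_i‖_0`. -/
def gradNorm (v : Vel Ω) : ℝ := √(∑ i, ‖gradOf (v i)‖ ^ 2)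

/-- `‖K‖_div = (‖K‖_0^2 + ‖∇ · K‖_0^2)^(1/2)`. -/
def divNorm (K : H0div Ω) : ℝ := √(‖fieldOf K‖ ^ 2 + ‖divOf K‖ ^ 2)

/-- `‖(w, K)‖_1 = (‖∇w‖_0^2 + ‖K‖_div^2)^(1/2)`. -/
def norm1 (η : VelCur Ω) : ℝ := √(gradNorm η.1 ^ 2 + divNorm η.2 ^ 2)

/-- `‖(q, ψ)‖_0 = (‖q‖_0^2 + ‖ψ‖_0^2)^(1/2)`. -/
def norm0 (ξ : PrePot Ω) : ℝ :=
  √(‖ξ.1‖ ^ 2 + ‖ξ.2‖ ^ 2)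

/-- `‖f‖_{-1} = sup ⟨f, v⟩ / ‖∇v‖_0` for `f` in the dual `H^{-1}(Ω)^d` of `H^1_0(Ω)^d`. -/
def dualNormVel (f : Vel Ω →L[ℝ] ℝ) : ℝ := ⨆ v : {v : Vel Ω // v ≠ 0}, f v.1 / gradNorm v.1

/-- `‖φ‖_{-1} = sup ⟨φ, r⟩ / ‖∇r‖_0` for `φ` in the dual `H^{-1}(Ω)` of `H^1_0(Ω)`. -/
def dualNorm (φ : H10 Ω →L[ℝ] ℝ) : ℝ := ⨆ r : {r : H10 Ω // r ≠ 0}, φ r.1 / ‖gradOf r.1‖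

/-- `l₁`, `l₂`, `C` are positive constants for which
`‖v‖_{L^6} ≤ l₁ ‖∇v‖_0`, `‖v‖_{L^4}^2 ≤ l₂ ‖∇v‖_0^2`, `‖v‖_0 ≤ C ‖∇v‖_0`
hold for all `v` in `H^1_0(Ω)^d` and for all `v` in `H^1_0(Ω)`. The left-hand sides are taken in
`[0, ∞]`, so that finiteness is part of the inequalities. -/
structure IsEmbeddingConstants (Ω : Set (Pt d)) (l₁ l₂ C : ℝ) : Prop where
  pos₁ : 0 < l₁
  pos₂ : 0 < l₂
  pos : 0 < C
  vel_six : ∀ v : Vel Ω, eLpNorm (velFn v) 6 (volume.restrict Ω) ≤ ENNReal.ofReal (l₁ * gradNorm v)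
  vel_four : ∀ v : Vel Ω,
    eLpNorm (velFn v) 4 (volume.restrict Ω) ^ 2 ≤ ENNReal.ofReal (l₂ * gradNorm v ^ 2)
  vel_two : ∀ v : Vel Ω, eLpNorm (velFn v) 2 (volume.restrict Ω) ≤ ENNReal.ofReal (C * gradNorm v)
  scalar_six : ∀ r : H10 Ω,
    eLpNorm (fnOf r) 6 (volume.restrict Ω) ≤ ENNReal.ofReal (l₁ * ‖gradOf r‖)
  scalar_four : ∀ r : H10 Ω,
    eLpNorm (fnOf r) 4 (volume.restrict Ω) ^ 2 ≤ ENNReal.ofReal (l₂ * ‖gradOf r‖ ^ 2)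
  scalar_two : ∀ r : H10 Ω,
    eLpNorm (fnOf r) 2 (volume.restrict Ω) ≤ ENNReal.ofReal (C * ‖gradOf r‖)

/-! ### Data and forms -/

/-- The data of the stationary thermally coupled inductionless MHD problem: the numbers `Pr`, `Ra`,
`κ`, the direction of buoyancy `i`, the applied magnetic field `B ∈ L^3(Ω)^3`, and the sources
`f ∈ H^{-1}(Ω)^d`, `g ∈ L^2(Ω)^d`, `φ ∈ H^{-1}(Ω)` (the last called `heat`). -/
structure Data (Ω : Set (Pt d)) where
  Pr : ℝ
  Ra : ℝ
  kappa : ℝ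
  dir : Pt d
  B : Lp (Pt 3) 3 (volume.restrict Ω)
  f : Vel Ω →L[ℝ] ℝ
  g : L2 Ω (Pt d)
  heat : H10 Ω →L[ℝ] ℝ

/-- A vector of `ℝ^d`, `d = 2, 3`, written as a vector of `ℝ^3`; a vector of `ℝ^2` gets the third
component zero. -/
def pad (v : Pt d) : Fin 3 → ℝ := fun i => if h : i.1 < d then v ⟨i.1, h⟩ else 0

namespace Data

variable (P : Data Ω)

/-- `d(K, v) = -κ (K × B, v)`. -/
def coupling (K : H0div Ω) (v : Vel Ω) : ℝ :=
  -P.kappa * ∫ x in Ω, ((pad (fieldOf K x)) ⨯₃ (P.B x).ofLp) ⬝ᵥ pad (velFn v x)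

/-- `A₀((u,J),(v,K)) = Pr (∇u, ∇v) + κ (J, K) + d(J, v) - d(K, u)`. -/
def A0 (η Φ : VelCur Ω) : ℝ :=
  P.Pr * ∑ i, inner ℝ (gradOf (η.1 i)) (gradOf (Φ.1 i)) + P.kappa * inner ℝ (fieldOf η.2) (fieldOf Φ.2)
    + P.coupling η.2 Φ.1 - P.coupling Φ.2 η.1

/-- `b_s(q, v) = -Pr (q, ∇ · v)`. -/
def bs (q : L20 Ω) (v : Vel Ω) : ℝ :=
  -P.Pr * ∫ x in Ω, q.1 x * velDiv v x

/-- `b_m(ψ, K) = -κ (ψ, ∇ · K)`. -/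
def bm (ψ : L20 Ω) (K : H0div Ω) : ℝ :=
  -P.kappa * inner ℝ ψ.1 (divOf K)

/-- `B((q,ψ),(v,K)) = b_s(q, v) + b_m(ψ, K)`. -/
def Bform (χ : PrePot Ω) (Φ : VelCur Ω) : ℝ :=
  P.bs χ.1 Φ.1 + P.bm χ.2 Φ.2

/-- `Q(θ,(v,K)) = -Pr Ra (θ i, v)`. -/
def Q (θ : H10 Ω) (Φ : VelCur Ω) : ℝ :=
  -(P.Pr * P.Ra) * ∫ x in Ω, fnOf θ x * inner ℝ P.dir (velFn Φ.1 x)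

/-- `⟨L,(v,K)⟩ = ⟨f, v⟩ + κ (g, K)`. -/
def load (Φ : VelCur Ω) : ℝ := P.f Φ.1 + P.kappa * inner ℝ P.g (fieldOf Φ.2)

/-- `‖L‖_* = (‖f‖_{-1}^2 + κ^2 ‖g‖_0^2)^(1/2)`. -/
def normL : ℝ := √(dualNormVel P.f ^ 2 + P.kappa ^ 2 * ‖P.g‖ ^ 2)

/-- `λ_ψ = ‖φ‖_{-1}`, the norm of the heat source. -/
def lamHeat : ℝ := dualNorm P.heat

/-- `λ_q = Pr Ra C^2`, with `C` the constant of the Poincaré inequality. -/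
def lamQ (C : ℝ) : ℝ := P.Pr * P.Ra * C ^ 2

/-- `C_min = min {Pr, κ}`. -/
def Cmin : ℝ := min P.Pr P.kappa

/-- `C_max = 2 max {Pr, κ, κ l₁ ‖B‖_{L^3}}`. -/
def Cmax (l₁ : ℝ) : ℝ := 2 * max P.Pr (max P.kappa (P.kappa * l₁ * ‖P.B‖))

/-- The number `σ` of the uniqueness condition. -/
def sigma (l₂ C : ℝ) : ℝ :=
  l₂ * P.normL / P.Cmin ^ 2 + l₂ * P.lamQ C * P.lamHeat / P.Cmin ^ 2
    + l₂ * P.lamQ C * P.lamHeat / P.Cmin + l₂ * P.normL / P.Cmin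

end Data

/-- `A₁((w,M),(u,J),(v,K)) = c(w,u,v) = ½ ((w · ∇)u, v) - ½ ((w · ∇)v, u)`. -/
def A1 (ζ η Φ : VelCur Ω) : ℝ :=
  1 / 2 * (∫ x in Ω, inner ℝ (convect (velFn ζ.1) η.1 x) (velFn Φ.1 x))
    - 1 / 2 * ∫ x in Ω, inner ℝ (convect (velFn ζ.1) Φ.1 x) (velFn η.1 x)

/-- `e(θ, r) = (∇θ, ∇r)`. -/
def eform (θ r : H10 Ω) : ℝ := inner ℝ (gradOf θ) (gradOf r)

/-- `H((u,J),θ,r) = h(u,θ,r) = ½ ((u · ∇)θ, r) - ½ ((u · ∇)r, θ)`. -/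
def Hform (η : VelCur Ω) (θ r : H10 Ω) : ℝ :=
  1 / 2 * (∫ x in Ω, inner ℝ (velFn η.1 x) (gradOf θ x) * fnOf r x)
    - 1 / 2 * ∫ x in Ω, inner ℝ (velFn η.1 x) (gradOf r x) * fnOf θ x

/-! ### Finite element spaces, the discrete problem and the Stokes iteration -/

/-- Conforming discrete spaces for velocity, pressure, current density, potential, temperature. -/
structure FESpaces (Ω : Set (Pt d)) where
  X : Submodule ℝ (Vel Ω)
  E : Submodule ℝ (L20 Ω)
  Y : Submodule ℝ (H0div Ω)
  S : Submodule ℝ (L20 Ω)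
  Z : Submodule ℝ (H10 Ω)
  finX : FiniteDimensional ℝ X
  finE : FiniteDimensional ℝ E
  finY : FiniteDimensional ℝ Y
  finS : FiniteDimensional ℝ S
  finZ : FiniteDimensional ℝ Z

/-- The unknowns `η = (u, J)`, `ξ = (p, φ)` and `θ`. -/
@[ext]
structure State (Ω : Set (Pt d)) where
  η : VelCur Ω
  ξ : PrePot Ω
  θ : H10 Ω

namespace FESpaces

variable (F : FESpaces Ω)

/-- `D_h = X_h × Y_h`. -/
def D : Submodule ℝ (VelCur Ω) := F.X.prod F.Y

/-- `G_h = E_h × S_h`. -/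
def G : Submodule ℝ (PrePot Ω) := F.E.prod F.S

/-- Charge conservation: the divergence of a discrete current density lies in the discrete space
of potentials, `∇ · Y_h ⊆ S_h`. -/
def ChargeConservative : Prop := ∀ K ∈ F.Y, ∃ ψ ∈ F.S, ψ.1 = divOf K

/-- The inf-sup conditions on `X_h × E_h` and on `Y_h × S_h` with the constants `βs` and `βm`:
`inf_{q ≠ 0} sup_{v ≠ 0} b_s(q, v) / (‖∇v‖_0 ‖q‖_0) ≥ βs` and
`inf_{ψ ≠ 0} sup_{K ≠ 0} b_m(ψ, K) / (‖K‖_div ‖ψ‖_0) ≥ βm`. -/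
structure InfSup (P : Data Ω) (βs βm : ℝ) : Prop where
  hydro : ∀ q ∈ F.E, q ≠ 0 →
    βs ≤ ⨆ v : {v : Vel Ω // v ∈ F.X ∧ v ≠ 0}, P.bs q v.1 / (gradNorm v.1 * ‖q‖)
  electric : ∀ ψ ∈ F.S, ψ ≠ 0 →
    βm ≤ ⨆ K : {K : H0div Ω // K ∈ F.Y ∧ K ≠ 0}, P.bm ψ K.1 / (divNorm K.1 * ‖ψ‖)

/-- The unknowns lie in the discrete spaces. -/
def Contains (W : State Ω) : Prop := W.η ∈ F.D ∧ W.ξ ∈ F.G ∧ W.θ ∈ F.Z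

/-- `W` solves the nonlinear discrete problem. -/
structure IsSolution (P : Data Ω) (W : State Ω) : Prop where
  mem : F.Contains W
  momentum : ∀ Φ ∈ F.D, P.A0 W.η Φ + A1 W.η W.η Φ + P.Bform W.ξ Φ + P.Q W.θ Φ = P.load Φ
  mass : ∀ χ ∈ F.G, P.Bform χ W.η = 0
  energy : ∀ r ∈ F.Z, eform W.θ r + Hform W.η W.θ r = P.heat r

/-- `W` is the initial value of the iteration: it solves the discrete problem without convection. -/
structure IsInitial (P : Data Ω) (W : State Ω) : Prop where
  mem : F.Contains W
  momentum : ∀ Φ ∈ F.D, P.A0 W.η Φ + P.Bform W.ξ Φ + P.Q W.θ Φ = P.load Φ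
  mass : ∀ χ ∈ F.G, P.Bform χ W.η = 0
  energy : ∀ r ∈ F.Z, eform W.θ r = P.heat r

/-- `W` is obtained from `W'` by one step of the Stokes iteration. -/
structure IsStokesStep (P : Data Ω) (W' W : State Ω) : Prop where
  mem : F.Contains W
  momentum : ∀ Φ ∈ F.D,
    P.A0 W.η Φ + A1 W'.η W'.η Φ + P.Bform W.ξ Φ + P.Q W.θ Φ = P.load Φ
  mass : ∀ χ ∈ F.G, P.Bform χ W.η = 0
  energy : ∀ r ∈ F.Z, eform W.θ r + Hform W'.η W'.θ r = P.heat r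

/-- `s 0, s 1, s 2, …` are the iterates of the Stokes iteration. -/
structure IsStokesIteration (P : Data Ω) (s : ℕ → State Ω) : Prop where
  initial : F.IsInitial P (s 0)
  step : ∀ n, F.IsStokesStep P (s n) (s (n + 1))

end FESpaces

end ThermalMHD

end

open ThermalMHD

/-! The initial problem, the iteration and the nonlinear problem all come from one solution
operator. `CoupledSaddle.IsStep p w` says that `w` solves the linear problem whose convection terms
are frozen at `p`. The initial value is a step from zero, the iteration is Picard iteration, and the
solutions are the fixed points.

Sizes are measured in units of the a priori bounds, (‖L‖_* + λ_q λ_ψ)/C_min for velocity and current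
and λ_ψ for the temperature gradient; `Small S k w` means at most `k` units in both. If two inputs
have sizes `k`, `k'` and differ by `a`, their images differ by at most `(k + k') σ a`
(`IsStep.sub_aux`). To see this, subtract the equations and test with the difference, which lies in
the kernel of `b`, so that the multipliers drop out. Telescoping the quadratic convection terms
produces `k + k'`, and coercivity absorbs the rest into σ.

All rates follow from this estimate. A solution has size 1 by skew-symmetry, and so has a step from
zero. Iterates keep size 2 because a step from size 2 deviates from the step from zero by at most 4σ
< 1. Between a solution and the iterates the factor is (1 + 2)σ = 3σ, between two solutions 2σ < 1,
and between two iterates 4σ < 1. The last bound makes the iteration Cauchy in finite dimension,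
which gives existence. Each linear problem is solvable since it is injective and square. The
multiplier error follows from the inf-sup condition and the momentum equation.

What remains is to verify the abstract assumptions. The Sobolev inequality on test functions passes
to H^1_0 by closure. Hölder's inequality with exponents (2,4,4), (2,3,6) and (2,2) bounds the
integrals. The Lorentz terms cancel on the diagonal, and charge conservation makes discrete kernel
currents exactly divergence free, so `A₀` is coercive there (`Data.A0_coercive`). The two inf-sup
conditions combine into one on the product space (`FESpaces.InfSup.min_mul_norm0_le`). -/

noncomputable section

/-! ### Abstract coupled saddle point problem -/

/-- The bilinear and trilinear forms of a saddle point problem coupled to a scalar equation, with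
seminorms for which they are bounded: `a₀` is coercive on the kernel of `b`, the convection forms
`a₁` and `h` are skew-symmetric in their last two arguments, and `b` satisfies an inf-sup
condition. -/
structure CoupledSaddle (D G Z : Type*) [AddCommGroup D] [Module ℝ D] [AddCommGroup G] [Module ℝ G]
    [AddCommGroup Z] [Module ℝ Z] where
  a₀ : D →ₗ[ℝ] D →ₗ[ℝ] ℝ
  a₁ : D →ₗ[ℝ] D →ₗ[ℝ] D →ₗ[ℝ] ℝ
  b : G →ₗ[ℝ] D →ₗ[ℝ] ℝ
  q : Z →ₗ[ℝ] D →ₗ[ℝ] ℝ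
  e : Z →ₗ[ℝ] Z →ₗ[ℝ] ℝ
  h : D →ₗ[ℝ] Z →ₗ[ℝ] Z →ₗ[ℝ] ℝ
  L : D →ₗ[ℝ] ℝ
  Ψ : Z →ₗ[ℝ] ℝ
  nD : Seminorm ℝ D
  nZ : Seminorm ℝ Z
  nG : G → ℝ
  eq_zero_of_nD : ∀ x, nD x = 0 → x = 0
  eq_zero_of_nZ : ∀ x, nZ x = 0 → x = 0
  eq_zero_of_nG : ∀ x, nG x ≤ 0 → x = 0
  cmin : ℝ
  cmax : ℝ
  ell : ℝ
  lq : ℝ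
  l₂ : ℝ
  lam : ℝ
  β : ℝ
  cmin_pos : 0 < cmin
  cmax_nonneg : 0 ≤ cmax
  ell_nonneg : 0 ≤ ell
  lq_nonneg : 0 ≤ lq
  l₂_nonneg : 0 ≤ l₂
  lam_nonneg : 0 ≤ lam
  β_pos : 0 < β
  coercive : ∀ x, (∀ χ, b χ x = 0) → cmin * nD x ^ 2 ≤ a₀ x x
  a₀_le : ∀ x y, |a₀ x y| ≤ cmax * nD x * nD y
  a₁_le : ∀ x y z, |a₁ x y z| ≤ l₂ * nD x * nD y * nD z
  a₁_self : ∀ x y, a₁ x y y = 0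
  q_le : ∀ θ y, |q θ y| ≤ lq * nZ θ * nD y
  e_self : ∀ θ, e θ θ = nZ θ ^ 2
  h_le : ∀ x θ r, |h x θ r| ≤ l₂ * nD x * nZ θ * nZ r
  h_self : ∀ x θ, h x θ θ = 0
  L_le : ∀ y, L y ≤ ell * nD y
  Ψ_le : ∀ r, Ψ r ≤ lam * nZ r
  infsup : ∀ χ R, 0 ≤ R → (∀ y, b χ y ≤ R * nD y) → β * nG χ ≤ R

namespace CoupledSaddle

variable {D G Z : Type*} [AddCommGroup D] [Module ℝ D] [AddCommGroup G] [Module ℝ G]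
    [AddCommGroup Z] [Module ℝ Z] (S : CoupledSaddle D G Z)

/-- `w` is obtained from `p` by solving the linear problem with the convection terms of `p`. -/
structure IsStep (p w : D × G × Z) : Prop where
  momentum : ∀ y, S.a₀ w.1 y + S.a₁ p.1 p.1 y + S.b w.2.1 y + S.q w.2.2 y = S.L y
  mass : ∀ χ, S.b χ w.1 = 0
  energy : ∀ r, S.e w.2.2 r + S.h p.1 p.2.2 r = S.Ψ r

/-- The a priori bound of the velocity. -/
def bd : ℝ := (S.ell + S.lq * S.lam) / S.cmin

/-- The constant of the smallness condition. -/
def sig : ℝ := S.l₂ * S.bd * (1 / S.cmin + 1)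

lemma bd_nonneg : 0 ≤ S.bd :=
  div_nonneg (add_nonneg S.ell_nonneg (mul_nonneg S.lq_nonneg S.lam_nonneg)) S.cmin_pos.le

lemma cmin_mul_bd : S.cmin * S.bd = S.ell + S.lq * S.lam := by
  have := S.cmin_pos.ne'
  unfold bd; field_simp

lemma cmin_mul_sig : S.cmin * S.sig = S.l₂ * S.bd * (1 + S.cmin) := by
  have := S.cmin_pos.ne'
  unfold sig; field_simp

lemma l₂_mul_bd_le_sig : S.l₂ * S.bd ≤ S.sig := by
  have h1 : 0 ≤ S.l₂ * S.bd := mul_nonneg S.l₂_nonneg S.bd_nonneg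
  have h2 : 0 < 1 / S.cmin := one_div_pos.2 S.cmin_pos
  unfold sig; nlinarith

lemma sig_nonneg : 0 ≤ S.sig :=
  (mul_nonneg S.l₂_nonneg S.bd_nonneg).trans S.l₂_mul_bd_le_sig

/-- Every energy estimate ends here: testing with the unknown itself gives a quadratic inequality,
and one factor of its norm is cancelled. The hypothesis `0 ≤ r` covers a vanishing norm. -/
lemma le_of_mul_self_le {c x r : ℝ} (hx : 0 ≤ x) (hr : 0 ≤ r)
    (h : c * x ^ 2 ≤ r * x) : c * x ≤ r := by
  rcases hx.eq_or_lt with rfl | hx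
  · simpa using hr
  · exact le_of_mul_le_mul_right (by linarith [sq x]) hx

variable {S}

/-- `x` and `θ` are bounded by `k` times the a priori bounds. -/
def Small (S : CoupledSaddle D G Z) (k : ℝ) (w : D × G × Z) : Prop :=
  S.nD w.1 ≤ k * S.bd ∧ S.nZ w.2.2 ≤ k * S.lam

/-- Telescoping, a₁(x,x,·) − a₁(x',x',·) = a₁(x−x',x,·) + a₁(x',x−x',·). The two terms contribute `k
* a` and `a * k'`. -/
lemma abs_a₁_sub_le {x x' : D} {a k k' : ℝ} (ha : 0 ≤ a) (hk' : 0 ≤ k')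
    (hx : S.nD x ≤ k * S.bd) (hx' : S.nD x' ≤ k' * S.bd) (hd : S.nD (x - x') ≤ a * S.bd) (y : D) :
    |S.a₁ x x y - S.a₁ x' x' y| ≤ S.l₂ * ((k + k') * a * S.bd ^ 2) * S.nD y := by
  have e : S.a₁ x x y - S.a₁ x' x' y = S.a₁ (x - x') x y + S.a₁ x' (x - x') y := by
    simp
  have hb := S.bd_nonneg
  have h2 := S.l₂_nonneg
  have hy := apply_nonneg S.nD y
  calc |S.a₁ x x y - S.a₁ x' x' y|
      ≤ |S.a₁ (x - x') x y| + |S.a₁ x' (x - x') y| := e ▸ abs_add_le _ _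
    _ ≤ S.l₂ * S.nD (x - x') * S.nD x * S.nD y + S.l₂ * S.nD x' * S.nD (x - x') * S.nD y :=
      add_le_add (S.a₁_le _ _ _) (S.a₁_le _ _ _)
    _ ≤ S.l₂ * (a * S.bd) * (k * S.bd) * S.nD y + S.l₂ * (k' * S.bd) * (a * S.bd) * S.nD y := by
      have := apply_nonneg S.nD x
      have := apply_nonneg S.nD (x - x')
      have := apply_nonneg S.nD x'
      gcongr
    _ = _ := by ring

lemma abs_h_sub_le {x x' : D} {θ θ' : Z} {a k k' : ℝ} (ha : 0 ≤ a) (hk' : 0 ≤ k')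
    (hx' : S.nD x' ≤ k' * S.bd) (hd : S.nD (x - x') ≤ a * S.bd)
    (hθ : S.nZ θ ≤ k * S.lam) (hdθ : S.nZ (θ - θ') ≤ a * S.lam) (r : Z) :
    |S.h x θ r - S.h x' θ' r| ≤ S.l₂ * ((k + k') * a * S.bd * S.lam) * S.nZ r := by
  have e : S.h x θ r - S.h x' θ' r = S.h (x - x') θ r + S.h x' (θ - θ') r := by
    simp
  have hb := S.bd_nonneg
  have h2 := S.l₂_nonneg
  have hy := apply_nonneg S.nZ r
  calc |S.h x θ r - S.h x' θ' r|
      ≤ |S.h (x - x') θ r| + |S.h x' (θ - θ') r| := e ▸ abs_add_le _ _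
    _ ≤ S.l₂ * S.nD (x - x') * S.nZ θ * S.nZ r + S.l₂ * S.nD x' * S.nZ (θ - θ') * S.nZ r :=
      add_le_add (S.h_le _ _ _) (S.h_le _ _ _)
    _ ≤ S.l₂ * (a * S.bd) * (k * S.lam) * S.nZ r + S.l₂ * (k' * S.bd) * (a * S.lam) * S.nZ r := by
      have := apply_nonneg S.nZ θ
      have := apply_nonneg S.nZ (θ - θ')
      have := apply_nonneg S.nD (x - x')
      have := apply_nonneg S.nD x'
      gcongr
    _ = _ := by ring

/-! ### Lipschitz estimate and a priori bounds for one step -/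

namespace IsStep

/-- The Lipschitz estimate for one step, with the estimate of the right-hand side of the momentum
balance of the differences. -/
lemma sub_aux {p p' w w' : D × G × Z} (H : S.IsStep p w) (H' : S.IsStep p' w') {a k k' : ℝ}
    (ha : 0 ≤ a) (hk : 0 ≤ k) (hk' : 0 ≤ k') (hp : Small S k p) (hp' : Small S k' p')
    (hd : Small S a (p - p')) :
    Small S ((k + k') * S.sig * a) (w - w') ∧
    ∀ y, |S.a₁ p.1 p.1 y - S.a₁ p'.1 p'.1 y + S.q (w.2.2 - w'.2.2) y| ≤
      S.cmin * ((k + k') * S.sig * a * S.bd) * S.nD y := by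
  have hb := S.bd_nonneg
  have h2 := S.l₂_nonneg
  have hlam := S.lam_nonneg
  have hlq := S.lq_nonneg
  have hcm := S.cmin_pos.le
  have hkk : 0 ≤ k + k' := by positivity
  -- The energy equation does not contain the new velocity, so the temperature is estimated first
  -- and then enters the momentum equation as data through `q`.
  have hθ : S.nZ (w.2.2 - w'.2.2) ≤ S.l₂ * ((k + k') * a * S.bd * S.lam) := by
    have h1 := abs_h_sub_le ha hk' hp'.1 hd.1 hp.2 hd.2 (w.2.2 - w'.2.2)
    have h3 : S.e (w.2.2 - w'.2.2) (w.2.2 - w'.2.2)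
        = -(S.h p.1 p.2.2 (w.2.2 - w'.2.2) - S.h p'.1 p'.2.2 (w.2.2 - w'.2.2)) := by
      have e1 := H.energy (w.2.2 - w'.2.2)
      have e2 := H'.energy (w.2.2 - w'.2.2)
      rw [map_sub S.e, LinearMap.sub_apply]
      linarith
    rw [S.e_self] at h3
    have := le_of_mul_self_le (c := 1) (x := S.nZ (w.2.2 - w'.2.2))
      (r := S.l₂ * ((k + k') * a * S.bd * S.lam)) (apply_nonneg _ _) (by positivity)
      (by rw [one_mul, h3]; exact (neg_le_abs _).trans h1)
    simpa using this
  have hR : ∀ y, |S.a₁ p.1 p.1 y - S.a₁ p'.1 p'.1 y + S.q (w.2.2 - w'.2.2) y| ≤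
      S.cmin * ((k + k') * S.sig * a * S.bd) * S.nD y := by
    intro y
    have hy := apply_nonneg S.nD y
    calc |S.a₁ p.1 p.1 y - S.a₁ p'.1 p'.1 y + S.q (w.2.2 - w'.2.2) y|
        ≤ |S.a₁ p.1 p.1 y - S.a₁ p'.1 p'.1 y| + |S.q (w.2.2 - w'.2.2) y| := abs_add_le _ _
      _ ≤ S.l₂ * ((k + k') * a * S.bd ^ 2) * S.nD y
          + S.lq * (S.l₂ * ((k + k') * a * S.bd * S.lam)) * S.nD y := by
        refine add_le_add (abs_a₁_sub_le ha hk' hp.1 hp'.1 hd.1 y) ((S.q_le _ _).trans ?_)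
        gcongr
      _ = (S.l₂ * (k + k') * a * S.bd * S.nD y) * (S.bd + S.lq * S.lam) := by ring
      -- Since `lq * lam ≤ ell + lq * lam = cmin * bd`, buoyancy costs at most `cmin` extra units.
      -- This is the source of the summand 1 in the factor `1 / cmin + 1` of `sig`.
      _ ≤ (S.l₂ * (k + k') * a * S.bd * S.nD y) * (S.bd + S.cmin * S.bd) := by
        refine mul_le_mul_of_nonneg_left ?_ (by positivity)
        linarith [S.ell_nonneg, S.cmin_mul_bd]
      _ = (S.l₂ * S.bd * (1 + S.cmin)) * ((k + k') * a * S.bd) * S.nD y := by ring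
      _ = _ := by rw [← S.cmin_mul_sig]; ring
  refine ⟨⟨?_, hθ.trans ?_⟩, hR⟩
  · have hker : ∀ χ, S.b χ (w.1 - w'.1) = 0 := fun χ => by rw [map_sub, H.mass, H'.mass, sub_zero]
    have e1 := H.momentum (w.1 - w'.1)
    have e2 := H'.momentum (w.1 - w'.1)
    have h3 : S.a₀ (w.1 - w'.1) (w.1 - w'.1) = -(S.a₁ p.1 p.1 (w.1 - w'.1)
        - S.a₁ p'.1 p'.1 (w.1 - w'.1) + S.q (w.2.2 - w'.2.2) (w.1 - w'.1)) := by
      rw [map_sub S.a₀, LinearMap.sub_apply, map_sub S.q, LinearMap.sub_apply]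
      linarith [hker w.2.1, hker w'.2.1]
    have h4 := le_of_mul_self_le (apply_nonneg S.nD (w.1 - w'.1))
      (by have := S.cmin_pos; have := S.sig_nonneg; positivity)
      ((S.coercive _ hker).trans (h3.trans_le ((neg_le_abs _).trans (hR _))))
    exact le_of_mul_le_mul_left h4 S.cmin_pos
  · calc S.l₂ * ((k + k') * a * S.bd * S.lam) = S.l₂ * S.bd * ((k + k') * a * S.lam) := by ring
      _ ≤ S.sig * ((k + k') * a * S.lam) := by
        gcongr
        exact S.l₂_mul_bd_le_sig
      _ = _ := by ring

/-- The difference of the multipliers of two steps. -/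
lemma multiplier_sub_le {p p' w w' : D × G × Z} (H : S.IsStep p w) (H' : S.IsStep p' w')
    {a k k' : ℝ} (ha : 0 ≤ a) (hk : 0 ≤ k) (hk' : 0 ≤ k') (hp : Small S k p) (hp' : Small S k' p')
    (hd : Small S a (p - p')) :
    S.β * S.nG (w.2.1 - w'.2.1) ≤ (S.cmax + S.cmin) * ((k + k') * S.sig * a * S.bd) := by
  obtain ⟨h1, h2⟩ := sub_aux H H' ha hk hk' hp hp' hd
  have hb := S.bd_nonneg
  have := S.cmin_pos
  have := S.cmax_nonneg
  have := S.sig_nonneg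
  refine S.infsup _ _ (by positivity) fun y => ?_
  have e1 := H.momentum y
  have e2 := H'.momentum y
  have e3 := S.a₀_le (w.1 - w'.1) y
  have hy := apply_nonneg S.nD y
  have e4 : S.cmax * S.nD (w.1 - w'.1) * S.nD y
      ≤ S.cmax * ((k + k') * S.sig * a * S.bd) * S.nD y := by
    gcongr
    exact h1.1
  have e5 := h2 y
  have : S.b (w.2.1 - w'.2.1) y = -S.a₀ (w.1 - w'.1) y
      - (S.a₁ p.1 p.1 y - S.a₁ p'.1 p'.1 y + S.q (w.2.2 - w'.2.2) y) := by
    simp only [map_sub, LinearMap.sub_apply]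
    linarith
  rw [this]
  linarith [neg_le_abs (S.a₀ (w.1 - w'.1) y),
    neg_le_abs (S.a₁ p.1 p.1 y - S.a₁ p'.1 p'.1 y + S.q (w.2.2 - w'.2.2) y)]

/-- A step from zero is bounded. -/
lemma small_of_zero {w : D × G × Z} (H : S.IsStep 0 w) : Small S 1 w := by
  have hθ : S.nZ w.2.2 ≤ S.lam := by
    have := le_of_mul_self_le (c := 1) (x := S.nZ w.2.2) (apply_nonneg _ _) S.lam_nonneg
      (by
        have := H.energy w.2.2
        simp only [S.e_self, Prod.fst_zero, map_zero, LinearMap.zero_apply, add_zero] at this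
        rw [one_mul, this]
        exact S.Ψ_le _)
    simpa using this
  refine ⟨?_, by simpa using hθ⟩
  have h1 := H.momentum w.1
  simp only [Prod.fst_zero, map_zero, LinearMap.zero_apply, add_zero, H.mass] at h1
  have hw := apply_nonneg S.nD w.1
  have h2 := S.q_le w.2.2 w.1
  have h3 : S.lq * S.nZ w.2.2 * S.nD w.1 ≤ S.lq * S.lam * S.nD w.1 := by
    have := S.lq_nonneg
    gcongr
  have h4 := le_of_mul_self_le hw
    (add_nonneg S.ell_nonneg (mul_nonneg S.lq_nonneg S.lam_nonneg))
    ((S.coercive _ H.mass).trans (show _ ≤ (S.ell + S.lq * S.lam) * _ by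
      linarith [S.L_le w.1, neg_le_abs (S.q w.2.2 w.1)]))
  rw [← S.cmin_mul_bd] at h4
  simpa using le_of_mul_le_mul_left h4 S.cmin_pos

/-- A solution of the nonlinear problem is bounded. -/
lemma small_of_self {w : D × G × Z} (H : S.IsStep w w) : Small S 1 w := by
  have hθ : S.nZ w.2.2 ≤ S.lam := by
    have := le_of_mul_self_le (c := 1) (x := S.nZ w.2.2) (apply_nonneg _ _) S.lam_nonneg
      (by
        have := H.energy w.2.2
        simp only [S.e_self, S.h_self, add_zero] at this
        rw [one_mul, this]
        exact S.Ψ_le _)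
    simpa using this
  refine ⟨?_, by simpa using hθ⟩
  have h1 := H.momentum w.1
  simp only [S.a₁_self, add_zero, H.mass] at h1
  have hw := apply_nonneg S.nD w.1
  have h2 := S.q_le w.2.2 w.1
  have h3 : S.lq * S.nZ w.2.2 * S.nD w.1 ≤ S.lq * S.lam * S.nD w.1 := by
    have := S.lq_nonneg
    gcongr
  have h4 := le_of_mul_self_le hw
    (add_nonneg S.ell_nonneg (mul_nonneg S.lq_nonneg S.lam_nonneg))
    ((S.coercive _ H.mass).trans (show _ ≤ (S.ell + S.lq * S.lam) * _ by
      linarith [S.L_le w.1, neg_le_abs (S.q w.2.2 w.1)]))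
  rw [← S.cmin_mul_bd] at h4
  simpa using le_of_mul_le_mul_left h4 S.cmin_pos

end IsStep

/-! ### Calculus of the size bounds -/

lemma Small.zero (S : CoupledSaddle D G Z) : Small S 0 0 := by
  constructor <;> simp

lemma Small.mono {w : D × G × Z} {k k' : ℝ} (h : Small S k w) (hk : k ≤ k') : Small S k' w :=
  ⟨h.1.trans (mul_le_mul_of_nonneg_right hk S.bd_nonneg),
    h.2.trans (mul_le_mul_of_nonneg_right hk S.lam_nonneg)⟩

lemma Small.add {w w' : D × G × Z} {k k' : ℝ} (h : Small S k w) (h' : Small S k' w') :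
    Small S (k + k') (w + w') := by
  constructor
  · rw [add_mul]
    exact (map_add_le_add S.nD _ _).trans (add_le_add h.1 h'.1)
  · rw [add_mul]
    exact (map_add_le_add S.nZ _ _).trans (add_le_add h.2 h'.2)

lemma Small.neg {w : D × G × Z} {k : ℝ} (h : Small S k w) : Small S k (-w) := by
  constructor
  · simpa using h.1
  · simpa using h.2

lemma Small.sub {w w' : D × G × Z} {k k' : ℝ} (h : Small S k w) (h' : Small S k' w') :
    Small S (k + k') (w - w') := by
  rw [sub_eq_add_neg]
  exact h.add h'.neg

/-- If `w` is `a n`-small for a sequence `a` with limit zero, then `w` vanishes. -/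
lemma eq_zero_of_small {w : D × G × Z} {a : ℕ → ℝ}
    (ha : Filter.Tendsto a Filter.atTop (nhds 0)) (h : ∀ n, Small S (a n) w) :
    w.1 = 0 ∧ w.2.2 = 0 := by
  constructor
  · refine S.eq_zero_of_nD _ (le_antisymm ?_ (apply_nonneg _ _))
    have := ha.mul_const S.bd
    rw [zero_mul] at this
    exact ge_of_tendsto' this fun n => (h n).1
  · refine S.eq_zero_of_nZ _ (le_antisymm ?_ (apply_nonneg _ _))
    have := ha.mul_const S.lam
    rw [zero_mul] at this
    exact ge_of_tendsto' this fun n => (h n).2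

/-! ### Invariance of size 2, and uniqueness -/

namespace IsStep

lemma small_two {p w : D × G × Z} (hσ : S.sig < 1 / 4) (hp : Small S 2 p) (H : S.IsStep p w)
    {w₀ : D × G × Z} (H₀ : S.IsStep 0 w₀) : Small S 2 w := by
  -- Compared with the step from zero, the deviation is `(2 + 0) * sig * 2 = 4 * sig < 1`; that step
  -- itself has size 1.
  have h1 := (sub_aux H H₀ (a := 2) (k := 2) (k' := 0) (by norm_num) (by norm_num) le_rfl hp
    (Small.zero S) (by simpa using hp)).1
  have h2 := h1.add H₀.small_of_zero
  rw [sub_add_cancel] at h2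
  exact h2.mono (by linarith)

/-- The Lipschitz estimate with equal inputs, that is `a = 0`, forces all three differences to
vanish. -/
lemma unique {p w w' : D × G × Z} {k : ℝ} (hk : 0 ≤ k) (hp : Small S k p) (H : S.IsStep p w)
    (H' : S.IsStep p w') : w = w' := by
  have hz : Small S 0 (p - p) := by simpa using Small.zero S
  have h1 := (sub_aux H H' le_rfl hk hk hp hp hz).1
  have h2 := multiplier_sub_le H H' le_rfl hk hk hp hp hz
  rw [mul_zero] at h1
  have h3 := eq_zero_of_small (a := fun _ => 0) tendsto_const_nhds fun _ => h1
  have h4 : w.2.1 - w'.2.1 = 0 := by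
    refine S.eq_zero_of_nG _ ?_
    have := S.β_pos
    by_contra! h
    have : 0 < S.β * S.nG (w.2.1 - w'.2.1) := by positivity
    simp at h2
    linarith
  exact Prod.ext (sub_eq_zero.1 h3.1) (Prod.ext (sub_eq_zero.1 h4) (sub_eq_zero.1 h3.2))

/-- Two fixed points have size 1, so the Lipschitz estimate reproduces their difference with factor
2σ < 1 and can be iterated. The multipliers then agree by the estimate with `a = 0`. -/
lemma self_unique (hσ : S.sig < 1 / 4) {w w' : D × G × Z} (H : S.IsStep w w)
    (H' : S.IsStep w' w') : w = w' := by
  have hs := H.small_of_self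
  have hs' := H'.small_of_self
  have h0 := S.sig_nonneg
  have h1 : ∀ n : ℕ, Small S (((1 + 1) * S.sig) ^ n * (1 + 1)) (w - w') := by
    intro n
    induction n with
    | zero => simpa using hs.sub hs'
    | succ n ih =>
      have := (sub_aux H H' (by positivity) zero_le_one zero_le_one hs hs' ih).1
      rwa [← mul_assoc, ← pow_succ'] at this
  have h2 : Filter.Tendsto (fun n : ℕ => ((1 + 1) * S.sig) ^ n * (1 + 1)) Filter.atTop (nhds 0) := by
    have := (tendsto_pow_atTop_nhds_zero_of_lt_one (r := (1 + 1) * S.sig) (by positivity)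
      (by linarith)).mul_const (1 + 1)
    rwa [zero_mul] at this
  have h3 := eq_zero_of_small h2 h1
  have hz : Small S 0 (w - w') := by
    constructor
    · simp only [h3.1, map_zero, zero_mul, le_refl]
    · simp only [h3.2, map_zero, zero_mul, le_refl]
  have h4 := multiplier_sub_le H H' le_rfl zero_le_one zero_le_one hs hs' hz
  have h5 : w.2.1 - w'.2.1 = 0 := by
    refine S.eq_zero_of_nG _ ?_
    have := S.β_pos
    by_contra! h
    have : 0 < S.β * S.nG (w.2.1 - w'.2.1) := by positivity
    simp at h4
    linarith
  exact Prod.ext (sub_eq_zero.1 h3.1) (Prod.ext (sub_eq_zero.1 h5) (sub_eq_zero.1 h3.2))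

end IsStep

/-! ### Solvability of one step and existence of a fixed point -/

section Existence

/-- The linear map of the linear problem solved in each step. -/
def system (S : CoupledSaddle D G Z) :
    (D × G × Z) →ₗ[ℝ] Module.Dual ℝ D × Module.Dual ℝ G × Module.Dual ℝ Z :=
  (S.a₀.coprod (S.b.coprod S.q)).prod
    ((S.b.flip ∘ₗ LinearMap.fst ℝ D (G × Z)).prod
      (S.e ∘ₗ LinearMap.snd ℝ G Z ∘ₗ LinearMap.snd ℝ D (G × Z)))

/-- The homogeneous system is solved in triangular order: the energy equation kills the temperature,
coercivity on the kernel of `b` the velocity, and the inf-sup condition with `R = 0` the multiplier.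
-/
lemma system_injective (S : CoupledSaddle D G Z) : Function.Injective S.system := by
  rw [injective_iff_map_eq_zero]
  intro w hw
  have h1 := congrArg Prod.fst hw
  have h2 := congrArg (fun z => z.2.1) hw
  have h3 := congrArg (fun z => z.2.2) hw
  have h1' : ∀ y, S.a₀ w.1 y + (S.b w.2.1 y + S.q w.2.2 y) = 0 := fun y =>
    LinearMap.congr_fun h1 y
  have h2' : ∀ χ, S.b χ w.1 = 0 := fun χ => LinearMap.congr_fun h2 χ
  have h3' : S.e w.2.2 w.2.2 = 0 := LinearMap.congr_fun h3 w.2.2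
  have hθ : w.2.2 = 0 := S.eq_zero_of_nZ _ (by rw [S.e_self] at h3'; exact pow_eq_zero_iff two_ne_zero |>.1 h3')
  have hx : w.1 = 0 := by
    refine S.eq_zero_of_nD _ ?_
    have e1 := S.coercive _ h2'
    have e2 := h1' w.1
    rw [h2', hθ] at e2
    simp only [map_zero, LinearMap.zero_apply, add_zero] at e2
    rw [e2] at e1
    have := S.cmin_pos
    have : S.nD w.1 ^ 2 ≤ 0 := by
      by_contra! h
      have : 0 < S.cmin * S.nD w.1 ^ 2 := by positivity
      linarith
    exact pow_eq_zero_iff two_ne_zero |>.1 (le_antisymm this (sq_nonneg _))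
  have hξ : w.2.1 = 0 := by
    refine S.eq_zero_of_nG _ ?_
    have := S.infsup w.2.1 0 le_rfl fun y => by
      have := h1' y
      simp only [hx, hθ, map_zero, LinearMap.zero_apply, add_zero, zero_add] at this
      simp [this]
    have := S.β_pos
    by_contra! h
    have : 0 < S.β * S.nG w.2.1 := by positivity
    linarith
  exact Prod.ext hx (Prod.ext hξ hθ)

variable [FiniteDimensional ℝ D] [FiniteDimensional ℝ G] [FiniteDimensional ℝ Z]

lemma exists_isStep (S : CoupledSaddle D G Z) (p : D × G × Z) : ∃ w, S.IsStep p w := by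
  have hs : Function.Surjective S.system := by
    -- The target is the product of the dual spaces, hence of the same finite dimension as the
    -- source.
    rw [← LinearMap.injective_iff_surjective_of_finrank_eq_finrank]
    · exact S.system_injective
    · simp [Module.finrank_prod, Subspace.dual_finrank_eq]
  obtain ⟨w, hw⟩ := hs (S.L - S.a₁ p.1 p.1, 0, S.Ψ - S.h p.1 p.2.2)
  have h1 := congrArg Prod.fst hw
  have h2 := congrArg (fun z => z.2.1) hw
  have h3 := congrArg (fun z => z.2.2) hw
  refine ⟨w, fun y => ?_, fun χ => LinearMap.congr_fun h2 χ, fun r => ?_⟩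
  · have : S.a₀ w.1 y + (S.b w.2.1 y + S.q w.2.2 y) = S.L y - S.a₁ p.1 p.1 y :=
      LinearMap.congr_fun h1 y
    linarith
  · have : S.e w.2.2 r = S.Ψ r - S.h p.1 p.2.2 r := LinearMap.congr_fun h3 r
    linarith

/-- A sequence in a finite-dimensional space whose increments decay geometrically with respect to
a norm converges geometrically. -/
lemma exists_limit_of_geometric {V : Type*} [AddCommGroup V] [Module ℝ V] [FiniteDimensional ℝ V]
    (N : Seminorm ℝ V) (hN : ∀ x, N x = 0 → x = 0) (u : ℕ → V) {c r : ℝ} (hr : r < 1)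
    (h : ∀ n, N (u n - u (n + 1)) ≤ c * r ^ n) :
    ∃ x, ∀ n, N (u n - x) ≤ c * r ^ n / (1 - r) := by
  -- The definite seminorm is made the norm of `V`; completeness is automatic in finite dimension.
  let _ : NormedAddCommGroup V := AddGroupNorm.toNormedAddCommGroup
    { N with eq_zero_of_map_eq_zero' := hN, neg' := map_neg_eq_map N }
  let _ : NormedSpace ℝ V := ⟨fun a b => (map_smul_eq_mul N a b).le⟩
  have hd : ∀ x y : V, dist x y = N (x - y) := fun x y => dist_eq_norm_sub x y
  have : CompleteSpace V := FiniteDimensional.complete ℝ V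
  have h' : ∀ n, dist (u n) (u (n + 1)) ≤ c * r ^ n := fun n => by rw [hd]; exact h n
  obtain ⟨x, hx⟩ := cauchySeq_tendsto_of_complete (cauchySeq_of_le_geometric r c hr h')
  exact ⟨x, fun n => by rw [← hd]; exact dist_le_of_le_geometric_of_tendsto r c hr h' hx n⟩

lemma exists_isStep_self (S : CoupledSaddle D G Z) (hσ : S.sig < 1 / 4) : ∃ w, S.IsStep w w := by
  choose f hf using S.exists_isStep
  set t : ℕ → D × G × Z := fun n => f^[n] (f 0) with ht
  have hstep : ∀ n, S.IsStep (t n) (t (n + 1)) := fun n => by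
    simp only [ht, Function.iterate_succ_apply']
    exact hf _
  have hsmall : ∀ n, Small S 2 (t n) := by
    intro n
    induction n with
    | zero => exact (hf 0).small_of_zero.mono (by norm_num)
    | succ n ih => exact (hstep n).small_two hσ ih (hf 0)
  have h0 := S.sig_nonneg
  -- Two inputs of size 2 give the contraction factor 4σ; this is where σ < 1/4 is needed for
  -- convergence of the iterates.
  set r : ℝ := (2 + 2) * S.sig with hr
  have hr0 : 0 ≤ r := by positivity
  have hr1 : r < 1 := by linarith
  have hdiff : ∀ n, Small S (4 * r ^ n) (t n - t (n + 1)) := by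
    intro n
    induction n with
    | zero => exact ((hsmall 0).sub (hsmall 1)).mono (by norm_num)
    | succ n ih =>
      have := ((hstep n).sub_aux (hstep (n + 1)) (by positivity) zero_le_two zero_le_two (hsmall n)
        (hsmall (n + 1)) ih).1
      refine this.mono (le_of_eq ?_)
      rw [pow_succ, ← hr]; ring
  obtain ⟨x, hx⟩ := exists_limit_of_geometric S.nD S.eq_zero_of_nD (fun n => (t n).1)
    (c := 4 * S.bd) hr1 fun n => ((hdiff n).1.trans (le_of_eq (by ring)))
  obtain ⟨θ, hθ⟩ := exists_limit_of_geometric S.nZ S.eq_zero_of_nZ (fun n => (t n).2.2)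
    (c := 4 * S.lam) hr1 fun n => ((hdiff n).2.trans (le_of_eq (by ring)))
  -- A step reads only the velocity and the temperature of its input, so the multiplier of the limit
  -- may be arbitrary. The solution will be `f p`, which supplies the correct one.
  set p : D × G × Z := (x, 0, θ) with hp
  have hlim : ∀ n, Small S (4 / (1 - r) * r ^ n) (t n - p) := fun n =>
    ⟨(hx n).trans (le_of_eq (by ring)), (hθ n).trans (le_of_eq (by ring))⟩
  have htend : ∀ c : ℝ, Filter.Tendsto (fun n : ℕ => c * r ^ n) Filter.atTop (nhds 0) := fun c => by
    have := (tendsto_pow_atTop_nhds_zero_of_lt_one hr0 hr1).const_mul c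
    rwa [mul_zero] at this
  have hp2 : Small S 2 p := by
    have h1 : ∀ n, Small S (2 + 4 / (1 - r) * r ^ n) p := fun n => by
      have := (hsmall n).sub (hlim n)
      rwa [sub_sub_cancel] at this
    have h2 := (htend (4 / (1 - r))).const_add 2
    rw [add_zero] at h2
    exact ⟨ge_of_tendsto' (h2.mul_const _) fun n => (h1 n).1,
      ge_of_tendsto' (h2.mul_const _) fun n => (h1 n).2⟩
  have h1r : 0 < 1 - r := by linarith
  -- Both `p` and `f p` are close to `t (n + 1)`: the former by convergence, the latter by the
  -- Lipschitz estimate applied to `t n` and `p`.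
  have hfp : ∀ n, Small S (r * (4 / (1 - r) * r ^ n) + 4 / (1 - r) * r ^ (n + 1)) (p - f p) := by
    intro n
    have h1 := ((hstep n).sub_aux (hf p) (by positivity) zero_le_two zero_le_two (hsmall n)
      hp2 (hlim n)).1
    have h2 := h1.sub (hlim (n + 1))
    rwa [sub_sub_sub_cancel_left] at h2
  have h3 := eq_zero_of_small (a := fun n => (r * (4 / (1 - r)) + 4 / (1 - r) * r) * r ^ n) (htend _)
    fun n => (hfp n).mono (le_of_eq (by ring))
  refine ⟨f p, ?_, (hf p).mass, ?_⟩
  · intro y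
    rw [← (sub_eq_zero.1 h3.1 : p.1 = (f p).1)]
    simpa only [← (sub_eq_zero.1 h3.1 : p.1 = (f p).1)] using (hf p).momentum y
  · intro r
    rw [← (sub_eq_zero.1 h3.1 : p.1 = (f p).1)]
    simpa only [← (sub_eq_zero.1 h3.2 : p.2.2 = (f p).2.2)] using (hf p).energy r

end Existence

/-! ### Stability and convergence of the iteration -/

/-- The error estimates for the iteration. -/
theorem error_le (hσ : S.sig < 1 / 4) {w : D × G × Z} (H : S.IsStep w w) {s : ℕ → D × G × Z}
    (h0 : S.IsStep 0 (s 0)) (hs : ∀ n, S.IsStep (s n) (s (n + 1))) (n : ℕ) :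
    Small S 2 (s n) ∧ Small S ((3 * S.sig) ^ n) (w - s n) ∧
      S.β * S.nG (w.2.1 - (s n).2.1) ≤ (S.cmax + S.cmin) * ((3 * S.sig) ^ n * S.bd) := by
  have hσ0 := S.sig_nonneg
  have hw := H.small_of_self
  have hc : 0 ≤ S.cmax + S.cmin := add_nonneg S.cmax_nonneg S.cmin_pos.le
  have hb := S.bd_nonneg
  have hsmall : ∀ n, Small S 2 (s n) := by
    intro n
    induction n with
    | zero => exact h0.small_of_zero.mono (by norm_num)
    | succ n ih => exact (hs n).small_two hσ ih h0
  have herr : ∀ n, Small S ((3 * S.sig) ^ n) (w - s n) := by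
    intro n
    induction n with
    | zero =>
      -- The solution is a step from itself and `s 0` a step from zero, so the initial error is at
      -- most `(1 + 0) * sig * 1`, below one unit.
      have := (H.sub_aux h0 zero_le_one zero_le_one le_rfl hw (Small.zero S)
        (by simpa using hw)).1
      exact this.mono (by rw [pow_zero]; linarith)
    | succ n ih =>
      -- Sizes 1 for the solution and 2 for the iterate give the rate 3σ.
      have := (H.sub_aux (hs n) (by positivity) zero_le_one zero_le_two hw (hsmall n) ih).1
      exact this.mono (by rw [pow_succ']; linarith)
  refine ⟨hsmall n, herr n, ?_⟩
  -- The multiplier error is controlled by the error of the preceding input, which for `n = 0` is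
  -- the zero triple.
  cases n with
  | zero =>
    refine (H.multiplier_sub_le h0 zero_le_one zero_le_one le_rfl hw (Small.zero S)
      (by simpa using hw)).trans ?_
    gcongr
    rw [pow_zero]; linarith
  | succ n =>
    refine (H.multiplier_sub_le (hs n) (by positivity) zero_le_one zero_le_two hw (hsmall n)
      (herr n)).trans ?_
    gcongr
    rw [pow_succ']; linarith

/-- Existence, uniqueness, stability and convergence for the stationary problem and for the
iteration that starts from the linear problem without convection. -/
theorem wellPosed {D G Z : Type*} [AddCommGroup D] [Module ℝ D] [AddCommGroup G] [Module ℝ G]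
    [AddCommGroup Z] [Module ℝ Z] [FiniteDimensional ℝ D] [FiniteDimensional ℝ G]
    [FiniteDimensional ℝ Z] (S : CoupledSaddle D G Z) (hσ : S.sig < 1 / 4) :
    (∃! w, S.IsStep w w) ∧
    (∃! s : ℕ → D × G × Z, S.IsStep 0 (s 0) ∧ ∀ n, S.IsStep (s n) (s (n + 1))) ∧
    ∀ (w : D × G × Z) (s : ℕ → D × G × Z), S.IsStep w w → S.IsStep 0 (s 0) →
      (∀ n, S.IsStep (s n) (s (n + 1))) → ∀ n,
      S.nD (s n).1 ≤ 2 * S.bd ∧ S.nZ (s n).2.2 ≤ 2 * S.lam ∧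
      S.nD (w.1 - (s n).1) ≤ (3 * S.sig) ^ n * S.bd ∧
      S.nZ (w.2.2 - (s n).2.2) ≤ (3 * S.sig) ^ n * S.lam ∧
      ∀ c, S.cmax + S.cmin ≤ c →
        S.β * S.nG (w.2.1 - (s n).2.1) ≤ c * (3 * S.sig) ^ n * S.bd := by
  obtain ⟨w, hw⟩ := S.exists_isStep_self hσ
  refine ⟨⟨w, hw, fun w' hw' => IsStep.self_unique hσ hw' hw⟩, ?_, fun w s hw h0 hs n => ?_⟩
  · choose f hf using S.exists_isStep
    have hts : ∀ n, S.IsStep (f^[n] (f 0)) (f^[n + 1] (f 0)) := fun n => by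
      rw [Function.iterate_succ_apply']
      exact hf _
    refine ⟨fun n => f^[n] (f 0), ⟨hf 0, hts⟩, fun u hu => funext fun n => ?_⟩
    induction n with
    | zero => exact IsStep.unique le_rfl (Small.zero S) hu.1 (hf 0)
    | succ n ih =>
      have h1 := hu.2 n
      rw [ih] at h1
      exact IsStep.unique zero_le_two (error_le hσ hw (hf 0) hts n).1 h1 (hts n)
  · obtain ⟨h1, h2, h3⟩ := error_le hσ hw h0 hs n
    refine ⟨h1.1, h1.2, h2.1, h2.2, fun c hc => h3.trans ?_⟩
    rw [mul_assoc]
    exact mul_le_mul_of_nonneg_right hc (mul_nonneg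
      (pow_nonneg (mul_nonneg zero_le_three S.sig_nonneg) n) S.bd_nonneg)

end CoupledSaddle

end

/-! ### Sobolev embeddings of H^1_0 on a bounded open set -/

noncomputable section

namespace ThermalMHD

variable {d : ℕ} {Ω : Set (Pt d)}

open scoped NNReal ENNReal

/-- The Sobolev inequality `‖φ‖_{L^6} ≤ c ‖∇φ‖_{L^2}` for test functions. -/
lemma exists_sobolev_test (hd : d = 2 ∨ d = 3) (hbdd : Bornology.IsBounded Ω) :
    ∃ c : ℝ≥0, ∀ φ : Pt d → ℝ, ContDiff ℝ ∞ φ → tsupport φ ⊆ Ω →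
      eLpNorm φ 6 (volume.restrict Ω) ≤ c * eLpNorm (gradient φ) 2 (volume.restrict Ω) := by
  obtain ⟨p, hp1, hp2, hpd, hp6⟩ : ∃ p : ℝ≥0, 1 ≤ p ∧ p ≤ 2 ∧ p < d ∧
      (p : ℝ)⁻¹ - (d : ℝ)⁻¹ ≤ ((6 : ℝ≥0) : ℝ)⁻¹ := by
    rcases hd with rfl | rfl
    -- The Sobolev inequality needs `p < d`, which excludes `p = 2` in the plane. Here 2/3 − 1/2 =
    -- 1/6 is the critical relation for the target exponent 6, and boundedness of Ω later raises `p`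
    -- to 2.
    · refine ⟨3 / 2, ?_, ?_, ?_, by norm_num⟩
      · rw [← NNReal.coe_le_coe]; norm_num
      · rw [← NNReal.coe_le_coe]; norm_num
      · rw [← NNReal.coe_lt_coe]; norm_num
    · exact ⟨2, by norm_num, le_rfl, by norm_num, by norm_num⟩
  have hfin : volume.restrict Ω Set.univ ≠ ⊤ := by
    rw [Measure.restrict_apply_univ]; exact hbdd.measure_lt_top.ne
  set t : ℝ≥0∞ := volume.restrict Ω Set.univ ^ (1 / (p : ℝ≥0∞).toReal - 1 / (2 : ℝ≥0∞).toReal)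
    with ht
  have htt : t ≠ ⊤ := by
    refine ENNReal.rpow_ne_top_of_nonneg ?_ hfin
    have : (p : ℝ) ≤ 2 := by exact_mod_cast hp2
    have h1 : (0 : ℝ) < p := lt_of_lt_of_le one_pos (by exact_mod_cast hp1)
    simp only [ENNReal.coe_toReal, ENNReal.toReal_ofNat, sub_nonneg]
    exact one_div_le_one_div_of_le h1 this
  refine ⟨eLpNormLESNormFDerivOfLeConst ℝ volume Ω p 6 * t.toNNReal, fun φ hφ hs => ?_⟩
  have hsupp : Function.support φ ⊆ Ω := (subset_tsupport φ).trans hs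
  have hsupp' : Function.support (gradient φ) ⊆ Ω := fun x hx =>
    hs (support_fderiv_subset ℝ (by
      contrapose! hx
      rw [Function.notMem_support] at hx ⊢
      simp [gradient, hx]))
  have hgrad : eLpNorm (fderiv ℝ φ) p volume = eLpNorm (gradient φ) p volume :=
    eLpNorm_congr_norm_ae (Filter.Eventually.of_forall fun x => by simp [gradient])
  have h := eLpNorm_le_eLpNorm_fderiv_of_le (F := ℝ) (volume : Measure (Pt d)) (q := 6)
    (hφ.of_le (by simp)) hsupp hp1 (by simpa using hpd) (by simpa using hp6) hbdd
  have hm : AEStronglyMeasurable (gradient φ) (volume.restrict Ω) :=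
    ((InnerProductSpace.toDual ℝ (Pt d)).symm.continuous.comp
      (hφ.continuous_fderiv (by simp))).aestronglyMeasurable
  rw [hgrad, ← eLpNorm_restrict_eq_of_support_subset hsupp,
    ← eLpNorm_restrict_eq_of_support_subset hsupp'] at h
  calc eLpNorm φ 6 (volume.restrict Ω) ≤ _ := h
    _ ≤ eLpNormLESNormFDerivOfLeConst ℝ volume Ω p 6 *
        (eLpNorm (gradient φ) 2 (volume.restrict Ω) * t) := by
        gcongr
        exact eLpNorm_le_eLpNorm_mul_rpow_measure_univ (by exact_mod_cast hp2) hm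
    _ = _ := by
        rw [ENNReal.coe_mul, ENNReal.coe_toNNReal htt]; ring

/-- The Sobolev inequality on `H^1_0(Ω)`. -/
lemma exists_sobolev_six (hd : d = 2 ∨ d = 3) (hbdd : Bornology.IsBounded Ω) :
    ∃ c : ℝ≥0, ∀ r : H10 Ω,
      eLpNorm (fnOf r) 6 (volume.restrict Ω) ≤ c * ENNReal.ofReal ‖gradOf r‖ := by
  obtain ⟨c, hc⟩ := exists_sobolev_test hd hbdd
  refine ⟨c, fun r => ?_⟩
  have hr : (r : L2 Ω ℝ × L2 Ω (Pt d)) ∈ closure (gradTest Ω : Set (L2 Ω ℝ × L2 Ω (Pt d))) := r.2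
  obtain ⟨w, hw, hlim⟩ := mem_closure_iff_seq_limit.1 hr
  have h1 : Filter.Tendsto (fun n => (w n).1) Filter.atTop (nhds (fnOf r)) :=
    (continuous_fst.tendsto _).comp hlim
  have h2 : Filter.Tendsto (fun n => (w n).2) Filter.atTop (nhds (gradOf r)) :=
    (continuous_snd.tendsto _).comp hlim
  -- Convergence in L² gives an almost everywhere convergent subsequence, to which Fatou's lemma for
  -- the L⁶ norm applies.
  obtain ⟨ns, hns, hae⟩ := (tendstoInMeasure_of_tendsto_Lp h1).exists_seq_tendsto_ae
  have hbound : ∀ n, eLpNorm (w n).1 6 (volume.restrict Ω) ≤ c * ENNReal.ofReal ‖(w n).2‖ := by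
    intro n
    obtain ⟨φ, hφ, -, hs, e1, e2⟩ := hw n
    rw [eLpNorm_congr_ae e1, Lp.norm_def, ENNReal.ofReal_toReal (Lp.eLpNorm_ne_top _),
      eLpNorm_congr_ae e2]
    exact hc φ hφ hs
  have hlim2 : Filter.Tendsto (fun n => c * ENNReal.ofReal ‖(w (ns n)).2‖) Filter.atTop
      (nhds (c * ENNReal.ofReal ‖gradOf r‖)) := by
    refine ENNReal.Tendsto.const_mul ?_ (Or.inr ENNReal.coe_ne_top)
    exact ENNReal.tendsto_ofReal ((h2.comp hns.tendsto_atTop).norm)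
  calc eLpNorm (fnOf r) 6 (volume.restrict Ω)
      ≤ Filter.liminf (fun n => eLpNorm (w (ns n)).1 6 (volume.restrict Ω)) Filter.atTop :=
        Lp.eLpNorm_lim_le_liminf_eLpNorm (fun n => Lp.aestronglyMeasurable _) _ hae
    _ ≤ Filter.liminf (fun n => c * ENNReal.ofReal ‖(w (ns n)).2‖) Filter.atTop :=
        Filter.liminf_le_liminf (Filter.Eventually.of_forall fun n => hbound (ns n))
    _ = _ := hlim2.liminf_eq

/-- The embedding of `H^1_0(Ω)` into `L^p(Ω)` for `p ≤ 6`. -/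
lemma exists_sobolev (hd : d = 2 ∨ d = 3) (hbdd : Bornology.IsBounded Ω) {p : ℝ≥0∞} (hp0 : 1 ≤ p)
    (hp : p ≤ 6) : ∃ c : ℝ, 0 < c ∧ ∀ r : H10 Ω,
      eLpNorm (fnOf r) p (volume.restrict Ω) ≤ ENNReal.ofReal (c * ‖gradOf r‖) := by
  obtain ⟨c, hc⟩ := exists_sobolev_six hd hbdd
  have hfin : volume.restrict Ω Set.univ ≠ ⊤ := by
    rw [Measure.restrict_apply_univ]; exact hbdd.measure_lt_top.ne
  set t : ℝ≥0∞ := volume.restrict Ω Set.univ ^ (1 / p.toReal - 1 / (6 : ℝ≥0∞).toReal) with ht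
  have hpt : p ≠ ⊤ := ne_top_of_le_ne_top (by simp) hp
  have htt : t ≠ ⊤ := by
    refine ENNReal.rpow_ne_top_of_nonneg ?_ hfin
    have h2 := ENNReal.toReal_mono (by simp) hp
    have h1 := ENNReal.toReal_mono hpt hp0
    rw [sub_nonneg]
    exact one_div_le_one_div_of_le (by rw [ENNReal.toReal_one] at h1; linarith) h2
  -- The added 1 only makes the constant strictly positive.
  refine ⟨c * t.toReal + 1, by positivity, fun r => ?_⟩
  calc eLpNorm (fnOf r) p (volume.restrict Ω)
      ≤ eLpNorm (fnOf r) 6 (volume.restrict Ω) * t :=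
        eLpNorm_le_eLpNorm_mul_rpow_measure_univ hp (Lp.aestronglyMeasurable _)
    _ ≤ c * ENNReal.ofReal ‖gradOf r‖ * t := by gcongr; exact hc r
    _ = ENNReal.ofReal (c * t.toReal * ‖gradOf r‖) := by
        rw [ENNReal.ofReal_mul (by positivity), ENNReal.ofReal_mul (by positivity),
          ENNReal.ofReal_coe_nnreal, ENNReal.ofReal_toReal htt]
        ring
    _ ≤ _ := ENNReal.ofReal_le_ofReal (by gcongr; linarith)

lemma norm_gradOf_le_gradNorm (v : Vel Ω) (i : Fin d) : ‖gradOf (v i)‖ ≤ gradNorm v := by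
  unfold gradNorm
  refine Real.le_sqrt_of_sq_le ?_
  exact Finset.single_le_sum (f := fun i => ‖gradOf (v i)‖ ^ 2) (fun _ _ => sq_nonneg _)
    (Finset.mem_univ i)

/-- The Euclidean norm is at most the sum of the absolute values of the components. The factor `d +
1` instead of `d` yields a constant that also dominates the scalar one. -/
lemma eLpNorm_velFn_le {p : ℝ≥0∞} (hp : 1 ≤ p) {c : ℝ} (hc : 0 < c)
    (h : ∀ r : H10 Ω, eLpNorm (fnOf r) p (volume.restrict Ω) ≤ ENNReal.ofReal (c * ‖gradOf r‖))
    (v : Vel Ω) :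
    eLpNorm (velFn v) p (volume.restrict Ω) ≤ ENNReal.ofReal ((d + 1) * c * gradNorm v) := by
  have hg : 0 ≤ gradNorm v := Real.sqrt_nonneg _
  calc eLpNorm (velFn v) p (volume.restrict Ω)
      ≤ eLpNorm (∑ i, fun x => ‖fnOf (v i) x‖) p (volume.restrict Ω) := by
        refine eLpNorm_mono_real fun x => ?_
        rw [EuclideanSpace.norm_eq, Finset.sum_apply]
        refine Real.sqrt_le_iff.2 ⟨by positivity, ?_⟩
        exact Finset.sum_sq_le_sq_sum_of_nonneg fun i _ => norm_nonneg _
    _ ≤ ∑ i, eLpNorm (fun x => ‖fnOf (v i) x‖) p (volume.restrict Ω) :=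
        eLpNorm_sum_le (fun i _ => (Lp.aestronglyMeasurable _).norm) hp
    _ ≤ ∑ _i : Fin d, ENNReal.ofReal (c * gradNorm v) := by
        refine Finset.sum_le_sum fun i _ => ?_
        rw [eLpNorm_norm]
        refine (h (v i)).trans (ENNReal.ofReal_le_ofReal ?_)
        gcongr
        exact norm_gradOf_le_gradNorm v i
    _ = ENNReal.ofReal (d * (c * gradNorm v)) := by
        rw [Finset.sum_const, Finset.card_univ, Fintype.card_fin, nsmul_eq_mul,
          ENNReal.ofReal_mul d.cast_nonneg, ENNReal.ofReal_natCast]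
    _ ≤ _ := ENNReal.ofReal_le_ofReal (by nlinarith [mul_nonneg hc.le hg])

/-- The scalar embeddings with exponents 6, 4 and 2 are enlarged to hold for vector fields as well.
The second constant is a square because the L⁴ inequality is stated for squares. -/
theorem exists_isEmbeddingConstants (hd : d = 2 ∨ d = 3) (hbdd : Bornology.IsBounded Ω) :
    ∃ l₁ l₂ C : ℝ, IsEmbeddingConstants Ω l₁ l₂ C := by
  obtain ⟨a, ha, h6⟩ := exists_sobolev (Ω := Ω) hd hbdd (p := 6) (by norm_num) le_rfl
  obtain ⟨b, hb, h4⟩ := exists_sobolev (Ω := Ω) hd hbdd (p := 4) (by norm_num) (by norm_num)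
  obtain ⟨c, hc, h2⟩ := exists_sobolev (Ω := Ω) hd hbdd (p := 2) (by norm_num) (by norm_num)
  have hscal : ∀ {x : ℝ} (r : H10 Ω), 0 < x → x * ‖gradOf r‖ ≤ (d + 1) * x * ‖gradOf r‖ :=
    fun r hx => by
      gcongr
      nlinarith [show (0 : ℝ) ≤ d from Nat.cast_nonneg d]
  refine ⟨(d + 1) * a, ((d + 1) * b) ^ 2, (d + 1) * c, by positivity, by positivity, by positivity,
    eLpNorm_velFn_le (by norm_num) ha h6, fun v => ?_, eLpNorm_velFn_le (by norm_num) hc h2,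
    fun r => (h6 r).trans (ENNReal.ofReal_le_ofReal (hscal r ha)), fun r => ?_,
    fun r => (h2 r).trans (ENNReal.ofReal_le_ofReal (hscal r hc))⟩
  · rw [← mul_pow, ENNReal.ofReal_pow (mul_nonneg (by positivity)
      (show 0 ≤ gradNorm v from Real.sqrt_nonneg _))]
    gcongr
    exact eLpNorm_velFn_le (by norm_num) hb h4 v
  · rw [← mul_pow, ENNReal.ofReal_pow (by positivity)]
    gcongr
    exact (h4 r).trans (ENNReal.ofReal_le_ofReal (hscal r hb))

end ThermalMHD

end

noncomputable section

namespace ThermalMHD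

open scoped NNReal ENNReal

/-! ### Hölder estimates -/

section Holder

variable {α : Type*} [MeasurableSpace α] {μ : Measure α}
  {E₁ E₂ E₃ : Type*} [NormedAddCommGroup E₁] [NormedAddCommGroup E₂] [NormedAddCommGroup E₃]

lemma eLpNorm_mul_norm_le {p q r : ℝ≥0∞} [ENNReal.HolderTriple p q r] {f : α → E₁} {g : α → E₂}
    {a b : ℝ} (ha : 0 ≤ a) (hf : AEStronglyMeasurable f μ) (hg : AEStronglyMeasurable g μ)
    (hfa : eLpNorm f p μ ≤ ENNReal.ofReal a) (hgb : eLpNorm g q μ ≤ ENNReal.ofReal b) :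
    eLpNorm (fun x => ‖f x‖ * ‖g x‖) r μ ≤ ENNReal.ofReal (a * b) := by
  have h := eLpNorm_smul_le_mul_eLpNorm (p := p) (q := q) (r := r) hg.norm hf.norm
  rw [eLpNorm_norm, eLpNorm_norm] at h
  rw [ENNReal.ofReal_mul ha]
  exact h.trans (mul_le_mul' hfa hgb)

lemma integrable_and_abs_integral_le {F : α → ℝ} (hF : AEStronglyMeasurable F μ) {a : ℝ}
    (ha : 0 ≤ a) (h : eLpNorm F 1 μ ≤ ENNReal.ofReal a) : Integrable F μ ∧ |∫ x, F x ∂μ| ≤ a := by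
  have hi : Integrable F μ := memLp_one_iff_integrable.1 ⟨hF, h.trans_lt ENNReal.ofReal_lt_top⟩
  refine ⟨hi, ?_⟩
  have h1 := norm_integral_le_lintegral_norm F (μ := μ)
  rw [eLpNorm_one_eq_lintegral_enorm] at h
  refine h1.trans (ENNReal.toReal_le_of_le_ofReal ha ?_)
  simpa only [ofReal_norm] using h

/-- The Hölder inequality for a product of two square integrable functions. -/
lemma integrable_and_abs_integral_le₂ {F : α → ℝ} (hF : AEStronglyMeasurable F μ) {f : α → E₁}
    {g : α → E₂} (hf : AEStronglyMeasurable f μ) (hg : AEStronglyMeasurable g μ)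
    (hle : ∀ᵐ x ∂μ, |F x| ≤ ‖f x‖ * ‖g x‖) {a b : ℝ} (ha : 0 ≤ a) (hb : 0 ≤ b)
    (hfa : eLpNorm f 2 μ ≤ ENNReal.ofReal a) (hgb : eLpNorm g 2 μ ≤ ENNReal.ofReal b) :
    Integrable F μ ∧ |∫ x, F x ∂μ| ≤ a * b :=
  integrable_and_abs_integral_le hF (by positivity)
    ((eLpNorm_mono_ae_real hle).trans (eLpNorm_mul_norm_le ha hf hg hfa hgb))

/-- The Hölder inequality for a product of three functions, one of them square integrable. -/
lemma integrable_and_abs_integral_le₃ {F : α → ℝ} (hF : AEStronglyMeasurable F μ) {f : α → E₁}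
    {g : α → E₂} {h : α → E₃} (hf : AEStronglyMeasurable f μ) (hg : AEStronglyMeasurable g μ)
    (hh : AEStronglyMeasurable h μ)
    (hle : ∀ᵐ x ∂μ, |F x| ≤ ‖f x‖ * (‖g x‖ * ‖h x‖)) {p q : ℝ≥0∞} [ENNReal.HolderTriple p q 2]
    {a b c : ℝ} (ha : 0 ≤ a) (hb : 0 ≤ b) (hc : 0 ≤ c)
    (hfa : eLpNorm f 2 μ ≤ ENNReal.ofReal a) (hgb : eLpNorm g p μ ≤ ENNReal.ofReal b)
    (hhc : eLpNorm h q μ ≤ ENNReal.ofReal c) :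
    Integrable F μ ∧ |∫ x, F x ∂μ| ≤ a * (b * c) := by
  refine integrable_and_abs_integral_le₂ hF hf (g := fun x => ‖g x‖ * ‖h x‖) (hg.norm.mul hh.norm)
    ?_ ha (by positivity) hfa (eLpNorm_mul_norm_le hb hg hh hgb hhc)
  filter_upwards [hle] with x hx
  rwa [Real.norm_of_nonneg (by positivity : 0 ≤ ‖g x‖ * ‖h x‖)]

/-- Exponents for the Lorentz force: current in L², magnetic field in L³, velocity in L⁶. -/
instance holderTriple_three_six_two : ENNReal.HolderTriple 3 6 2 := by
  have := Real.HolderTriple.ennrealOfReal (p := 3) (q := 6) (r := 2)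
    ⟨by norm_num, by norm_num, by norm_num⟩
  simpa using this

/-- Exponents for convection: a gradient in L² and two factors in L⁴. -/
instance holderTriple_four_four_two : ENNReal.HolderTriple 4 4 2 := by
  have := Real.HolderTriple.ennrealOfReal (p := 4) (q := 4) (r := 2)
    ⟨by norm_num, by norm_num, by norm_num⟩
  simpa using this

end Holder

/-! ### Families of functions depending linearly on a parameter almost everywhere -/

section AELinear

variable {α : Type*} [MeasurableSpace α] {μ : Measure α} {V V' E E' : Type*}
  [AddCommGroup V] [Module ℝ V] [AddCommGroup V'] [Module ℝ V'] [AddCommGroup E] [Module ℝ E]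
  [AddCommGroup E'] [Module ℝ E']

/-- `f v` depends linearly on `v` up to null sets. -/
structure AELinear (μ : Measure α) (f : V → α → E) : Prop where
  add : ∀ v w, ∀ᵐ x ∂μ, f (v + w) x = f v x + f w x
  smul : ∀ (c : ℝ) v, ∀ᵐ x ∂μ, f (c • v) x = c • f v x

/-- The operation `T x` may depend on the point, so the remaining arguments of a multilinear
integrand can be frozen inside it. -/
lemma AELinear.map {f : V → α → E} (hf : AELinear μ f) {T : α → E → E'}
    (hT : ∀ x, IsLinearMap ℝ (T x)) : AELinear μ fun v x => T x (f v x) where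
  add v w := by
    filter_upwards [hf.add v w] with x hx
    rw [hx, (hT x).map_add]
  smul c v := by
    filter_upwards [hf.smul c v] with x hx
    rw [hx, (hT x).map_smul]

lemma AELinear.comp {f : V → α → E} (hf : AELinear μ f) (g : V' →ₗ[ℝ] V) :
    AELinear μ fun v x => f (g v) x where
  add v w := by simpa only [map_add] using hf.add (g v) (g w)
  smul c v := by simpa only [map_smul] using hf.smul c (g v)

lemma AELinear.isLinearMap_integral {f : V → α → ℝ} (hf : AELinear μ f)
    (hi : ∀ v, Integrable (f v) μ) : IsLinearMap ℝ fun v => ∫ x, f v x ∂μ where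
  map_add v w := by rw [integral_congr_ae (hf.add v w), integral_add (hi v) (hi w)]
  map_smul c v := by rw [integral_congr_ae (hf.smul c v), integral_smul]

lemma AELinear.pi {ι : Type*} [Fintype ι] {f : V → α → E} (hf : AELinear μ f) :
    AELinear μ fun (v : ι → V) x i => f (v i) x where
  add v w := by
    have : ∀ᵐ x ∂μ, ∀ i, f (v i + w i) x = f (v i) x + f (w i) x :=
      ae_all_iff.2 fun i => hf.add (v i) (w i)
    filter_upwards [this] with x hx
    exact funext hx
  smul c v := by
    have : ∀ᵐ x ∂μ, ∀ i, f (c • v i) x = c • f (v i) x :=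
      ae_all_iff.2 fun i => hf.smul c (v i)
    filter_upwards [this] with x hx
    exact funext hx

lemma aeLinear_coeFn {F : Type*} [NormedAddCommGroup F] [NormedSpace ℝ F] {p : ℝ≥0∞} :
    AELinear μ fun (v : Lp F p μ) x => v x where
  add v w := Lp.coeFn_add v w
  smul c v := Lp.coeFn_smul c v

end AELinear

/-! ### The components of the unknowns -/

variable {d : ℕ} {Ω : Set (Pt d)}

/-- The value of an element of `H^1_0(Ω)`, as a linear map. -/
def fnL (Ω : Set (Pt d)) : H10 Ω →ₗ[ℝ] L2 Ω ℝ := LinearMap.fst ℝ _ _ ∘ₗ (H10 Ω).subtype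

/-- The gradient of an element of `H^1_0(Ω)`, as a linear map. -/
def gradL (Ω : Set (Pt d)) : H10 Ω →ₗ[ℝ] L2 Ω (Pt d) := LinearMap.snd ℝ _ _ ∘ₗ (H10 Ω).subtype

/-- The value of an element of `H_0(div, Ω)`, as a linear map. -/
def fieldL (Ω : Set (Pt d)) : H0div Ω →ₗ[ℝ] L2 Ω (Pt d) :=
  LinearMap.fst ℝ _ _ ∘ₗ (H0div Ω).subtype

/-- The divergence of an element of `H_0(div, Ω)`, as a linear map. -/
def divL (Ω : Set (Pt d)) : H0div Ω →ₗ[ℝ] L2 Ω ℝ := LinearMap.snd ℝ _ _ ∘ₗ (H0div Ω).subtype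

lemma aeLinear_fnOf : AELinear (volume.restrict Ω) fun (r : H10 Ω) x => fnOf r x :=
  aeLinear_coeFn.comp (fnL Ω)

lemma aeLinear_gradOf : AELinear (volume.restrict Ω) fun (r : H10 Ω) x => gradOf r x :=
  aeLinear_coeFn.comp (gradL Ω)

lemma aeLinear_fieldOf : AELinear (volume.restrict Ω) fun (K : H0div Ω) x => fieldOf K x :=
  aeLinear_coeFn.comp (fieldL Ω)

lemma aeLinear_velFn : AELinear (volume.restrict Ω) fun (v : Vel Ω) x => velFn v x :=
  aeLinear_fnOf.pi.map (T := fun _ => WithLp.toLp 2) fun _ => ⟨fun _ _ => rfl, fun _ _ => rfl⟩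

/-- The gradient of a velocity, with values in the matrices with the Frobenius norm. -/
def gradFn (v : Vel Ω) (x : Pt d) : PiLp 2 fun _ : Fin d => Pt d :=
  WithLp.toLp 2 fun i => gradOf (v i) x

lemma aeLinear_gradFn : AELinear (volume.restrict Ω) fun (v : Vel Ω) x => gradFn v x :=
  aeLinear_gradOf.pi.map (T := fun _ => WithLp.toLp 2) fun _ => ⟨fun _ _ => rfl, fun _ _ => rfl⟩

lemma aestronglyMeasurable_velFn (v : Vel Ω) :
    AEStronglyMeasurable (velFn v) (volume.restrict Ω) :=
  (PiLp.continuous_toLp 2 _).comp_aestronglyMeasurable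
    (aemeasurable_pi_iff.2 fun i =>
      (Lp.aestronglyMeasurable (fnOf (v i))).aemeasurable).aestronglyMeasurable

lemma aestronglyMeasurable_gradFn (v : Vel Ω) :
    AEStronglyMeasurable (gradFn v) (volume.restrict Ω) :=
  (PiLp.continuous_toLp 2 _).comp_aestronglyMeasurable
    (aemeasurable_pi_iff.2 fun i =>
      (Lp.aestronglyMeasurable (gradOf (v i))).aemeasurable).aestronglyMeasurable

lemma gradNorm_nonneg (v : Vel Ω) : 0 ≤ gradNorm v := Real.sqrt_nonneg _

lemma divNorm_nonneg (K : H0div Ω) : 0 ≤ divNorm K := Real.sqrt_nonneg _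

lemma gradNorm_sq (v : Vel Ω) : gradNorm v ^ 2 = ∑ i, ‖gradOf (v i)‖ ^ 2 :=
  Real.sq_sqrt (by positivity)

lemma divNorm_sq (K : H0div Ω) : divNorm K ^ 2 = ‖fieldOf K‖ ^ 2 + ‖divOf K‖ ^ 2 :=
  Real.sq_sqrt (by positivity)

lemma norm1_sq (η : VelCur Ω) : norm1 η ^ 2 = gradNorm η.1 ^ 2 + divNorm η.2 ^ 2 :=
  Real.sq_sqrt (by positivity)

lemma norm_fieldOf_le_divNorm (K : H0div Ω) : ‖fieldOf K‖ ≤ divNorm K :=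
  Real.le_sqrt_of_sq_le (by linarith [sq_nonneg ‖divOf K‖])

lemma gradNorm_le_norm1 (η : VelCur Ω) : gradNorm η.1 ≤ norm1 η :=
  Real.le_sqrt_of_sq_le (by linarith [sq_nonneg (divNorm η.2)])

lemma eLpNorm_coe_L2 {F : Type} [NormedAddCommGroup F] (f : L2 Ω F) :
    eLpNorm f 2 (volume.restrict Ω) = ENNReal.ofReal ‖f‖ := by
  rw [Lp.norm_def, ENNReal.ofReal_toReal (Lp.eLpNorm_ne_top _)]

lemma eLpNorm_two_sq {α F : Type*} [MeasurableSpace α] [NormedAddCommGroup F] {μ : Measure α}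
    (f : α → F) : eLpNorm f 2 μ ^ 2 = ∫⁻ x, ‖f x‖ₑ ^ 2 ∂μ := by
  have h := eLpNorm_nnreal_pow_eq_lintegral (μ := μ) (f := f) (p := 2) two_ne_zero
  simpa using h

lemma eLpNorm_gradFn_le (v : Vel Ω) :
    eLpNorm (gradFn v) 2 (volume.restrict Ω) ≤ ENNReal.ofReal (gradNorm v) := by
  have h : eLpNorm (gradFn v) 2 (volume.restrict Ω) ^ 2 = ENNReal.ofReal (gradNorm v) ^ 2 := by
    rw [eLpNorm_two_sq, ← ENNReal.ofReal_pow (gradNorm_nonneg v), gradNorm_sq,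
      ENNReal.ofReal_sum_of_nonneg fun _ _ => by positivity]
    have : ∀ x, ‖gradFn v x‖ₑ ^ 2 = ∑ i, ‖gradOf (v i) x‖ₑ ^ 2 := fun x => by
      simp only [← ofReal_norm]
      rw [← ENNReal.ofReal_pow (norm_nonneg _), PiLp.norm_sq_eq_of_L2,
        ENNReal.ofReal_sum_of_nonneg fun _ _ => by positivity]
      exact Finset.sum_congr rfl fun i _ => by rw [ENNReal.ofReal_pow (norm_nonneg _)]; rfl
    simp_rw [this]
    rw [lintegral_finsetSum' _ fun i _ =>
      (Lp.aestronglyMeasurable (gradOf (v i))).enorm.pow_const 2]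
    refine Finset.sum_congr rfl fun i _ => ?_
    rw [← eLpNorm_two_sq, eLpNorm_coe_L2, ENNReal.ofReal_pow (norm_nonneg _)]
  exact ((ENNReal.pow_right_strictMono two_ne_zero).injective h).le

lemma ofReal_sqrt_of_sq {e : ℝ≥0∞} {l g : ℝ} (hl : 0 < l) (hg : 0 ≤ g)
    (h : e ^ 2 ≤ ENNReal.ofReal (l * g ^ 2)) : e ≤ ENNReal.ofReal (√l * g) := by
  have : l * g ^ 2 = (√l * g) ^ 2 := by rw [mul_pow, Real.sq_sqrt hl.le]
  rw [this, ENNReal.ofReal_pow (by positivity)] at h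
  exact (ENNReal.pow_right_strictMono two_ne_zero).le_iff_le.1 h

namespace IsEmbeddingConstants

variable {l₁ l₂ C : ℝ}

lemma velFn_four (h : IsEmbeddingConstants Ω l₁ l₂ C) (v : Vel Ω) :
    eLpNorm (velFn v) 4 (volume.restrict Ω) ≤ ENNReal.ofReal (√l₂ * gradNorm v) :=
  ofReal_sqrt_of_sq h.pos₂ (gradNorm_nonneg v) (h.vel_four v)

lemma fnOf_four (h : IsEmbeddingConstants Ω l₁ l₂ C) (r : H10 Ω) :
    eLpNorm (fnOf r) 4 (volume.restrict Ω) ≤ ENNReal.ofReal (√l₂ * ‖gradOf r‖) :=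
  ofReal_sqrt_of_sq h.pos₂ (norm_nonneg _) (h.scalar_four r)

lemma norm_fnOf_le (h : IsEmbeddingConstants Ω l₁ l₂ C) (r : H10 Ω) :
    ‖fnOf r‖ ≤ C * ‖gradOf r‖ := by
  have := h.scalar_two r
  rw [eLpNorm_coe_L2] at this
  exact (ENNReal.ofReal_le_ofReal_iff (mul_nonneg h.pos.le (norm_nonneg _))).1 this

/-- By Poincaré's inequality the gradient alone controls the graph norm. This makes ‖∇·‖ definite
and the quotients in the dual norms bounded. -/
lemma norm_le_mul_norm_gradOf (h : IsEmbeddingConstants Ω l₁ l₂ C) (r : H10 Ω) :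
    ‖r‖ ≤ (C + 1) * ‖gradOf r‖ := by
  have h1 := h.norm_fnOf_le r
  have h2 := norm_nonneg (gradOf r)
  have h3 := mul_nonneg h.pos.le h2
  change max ‖fnOf r‖ ‖gradOf r‖ ≤ _
  exact max_le (by linarith) (by linarith)

lemma norm_le_mul_gradNorm (h : IsEmbeddingConstants Ω l₁ l₂ C) (v : Vel Ω) :
    ‖v‖ ≤ (C + 1) * gradNorm v := by
  have hC := h.pos
  refine (pi_norm_le_iff_of_nonneg (mul_nonneg (by positivity) (gradNorm_nonneg v))).2 fun i => ?_
  refine (h.norm_le_mul_norm_gradOf _).trans ?_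
  gcongr
  exact norm_gradOf_le_gradNorm v i

lemma eq_zero_of_gradOf (h : IsEmbeddingConstants Ω l₁ l₂ C) {r : H10 Ω} (hr : ‖gradOf r‖ = 0) :
    r = 0 := by
  have := h.norm_le_mul_norm_gradOf r
  rw [hr, mul_zero] at this
  exact norm_le_zero_iff.1 this

lemma eq_zero_of_gradNorm (h : IsEmbeddingConstants Ω l₁ l₂ C) {v : Vel Ω} (hv : gradNorm v = 0) :
    v = 0 := by
  have := h.norm_le_mul_gradNorm v
  rw [hv, mul_zero] at this
  exact norm_le_zero_iff.1 this

/-- A real supremum bounds its terms only if the set is bounded above; continuity of `f` and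
Poincaré's inequality give the bound `‖f‖ * (C + 1)`. -/
lemma le_dualNormVel_mul (h : IsEmbeddingConstants Ω l₁ l₂ C) (f : Vel Ω →L[ℝ] ℝ) (v : Vel Ω) :
    f v ≤ dualNormVel f * gradNorm v := by
  by_cases hv : v = 0
  · simp [hv, gradNorm, gradOf]
  · have hpos : 0 < gradNorm v :=
      (gradNorm_nonneg v).lt_of_ne' fun h0 => hv (h.eq_zero_of_gradNorm h0)
    rw [← div_le_iff₀ hpos]
    refine le_ciSup (f := fun v : {v : Vel Ω // v ≠ 0} => f v.1 / gradNorm v.1) ?_ ⟨v, hv⟩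
    refine ⟨‖f‖ * (C + 1), ?_⟩
    rintro _ ⟨w, rfl⟩
    refine div_le_of_le_mul₀ (gradNorm_nonneg _) (mul_nonneg (ContinuousLinearMap.opNorm_nonneg _)
      (by linarith [h.pos])) ?_
    rw [mul_assoc]
    exact (le_abs_self _).trans ((f.le_opNorm _).trans
      (mul_le_mul_of_nonneg_left (h.norm_le_mul_gradNorm _) (norm_nonneg _)))

lemma le_dualNorm_mul (h : IsEmbeddingConstants Ω l₁ l₂ C) (φ : H10 Ω →L[ℝ] ℝ) (r : H10 Ω) :
    φ r ≤ dualNorm φ * ‖gradOf r‖ := by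
  by_cases hr : r = 0
  · simp [hr, gradOf]
  · have hpos : 0 < ‖gradOf r‖ :=
      (norm_nonneg _).lt_of_ne' fun h0 => hr (h.eq_zero_of_gradOf h0)
    rw [← div_le_iff₀ hpos]
    refine le_ciSup (f := fun r : {r : H10 Ω // r ≠ 0} => φ r.1 / ‖gradOf r.1‖) ?_ ⟨r, hr⟩
    refine ⟨‖φ‖ * (C + 1), ?_⟩
    rintro _ ⟨w, rfl⟩
    refine div_le_of_le_mul₀ (norm_nonneg _) (mul_nonneg (ContinuousLinearMap.opNorm_nonneg _)
      (by linarith [h.pos])) ?_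
    rw [mul_assoc]
    exact (le_abs_self _).trans ((φ.le_opNorm _).trans
      (mul_le_mul_of_nonneg_left (h.norm_le_mul_norm_gradOf _) (norm_nonneg _)))

/-- The quotients at `r` and `-r` have opposite signs. In a trivial space the supremum is over the
empty set and equals zero. -/
lemma dualNorm_nonneg (h : IsEmbeddingConstants Ω l₁ l₂ C) (φ : H10 Ω →L[ℝ] ℝ) :
    0 ≤ dualNorm φ := by
  by_cases hne : ∃ r : H10 Ω, r ≠ 0
  · obtain ⟨r, hr⟩ := hne
    have hpos : 0 < ‖gradOf r‖ :=
      (norm_nonneg _).lt_of_ne' fun h0 => hr (h.eq_zero_of_gradOf h0)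
    have h1 := h.le_dualNorm_mul φ r
    have h2 := h.le_dualNorm_mul φ (-r)
    have h3 : ‖gradOf (-r)‖ = ‖gradOf r‖ := norm_neg (gradOf r)
    rw [map_neg, h3] at h2
    by_contra! hlt
    have := mul_neg_of_neg_of_pos hlt hpos
    linarith
  · push Not at hne
    have : IsEmpty {r : H10 Ω // r ≠ 0} := ⟨fun r => r.2 (hne r.1)⟩
    simp [dualNorm]

end IsEmbeddingConstants

end ThermalMHD

end

/-! ### The forms of the problem: multilinearity and bounds -/

noncomputable section

/-- A bilinear form from a function that is linear in each argument. -/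
def IsLinearMap.mk₂ {V₁ V₂ : Type*} [AddCommGroup V₁] [Module ℝ V₁] [AddCommGroup V₂] [Module ℝ V₂]
    (f : V₁ → V₂ → ℝ) (h₁ : ∀ y, IsLinearMap ℝ fun x => f x y) (h₂ : ∀ x, IsLinearMap ℝ (f x)) :
    V₁ →ₗ[ℝ] V₂ →ₗ[ℝ] ℝ :=
  LinearMap.mk₂ ℝ f (fun x x' y => (h₁ y).map_add x x') (fun c x y => (h₁ y).map_smul c x)
    (fun x => (h₂ x).map_add) fun c x y => (h₂ x).map_smul c y

/-- A trilinear form from a function that is linear in each argument. -/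
def IsLinearMap.mk₃ {V₁ V₂ V₃ : Type*} [AddCommGroup V₁] [Module ℝ V₁] [AddCommGroup V₂]
    [Module ℝ V₂] [AddCommGroup V₃] [Module ℝ V₃] (f : V₁ → V₂ → V₃ → ℝ)
    (h₁ : ∀ y z, IsLinearMap ℝ fun x => f x y z) (h₂ : ∀ x z, IsLinearMap ℝ fun y => f x y z)
    (h₃ : ∀ x y, IsLinearMap ℝ (f x y)) : V₁ →ₗ[ℝ] V₂ →ₗ[ℝ] V₃ →ₗ[ℝ] ℝ where
  toFun x := IsLinearMap.mk₂ (f x) (h₂ x) (h₃ x)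
  map_add' x x' := LinearMap.ext₂ fun y z => (h₁ y z).map_add x x'
  map_smul' c x := LinearMap.ext₂ fun y z => (h₁ y z).map_smul c x

namespace ThermalMHD

open scoped NNReal ENNReal

variable {d : ℕ} {Ω : Set (Pt d)} {l₁ l₂ C : ℝ}

/-! ### Convection of the velocity -/

lemma norm1_nonneg (η : VelCur Ω) : 0 ≤ norm1 η := Real.sqrt_nonneg _

/-- Cauchy–Schwarz in each component; summing the squares produces the Frobenius norm of the
gradient. -/
lemma norm_convect_le (a : Pt d → Pt d) (u : Vel Ω) (x : Pt d) :
    ‖convect a u x‖ ≤ ‖gradFn u x‖ * ‖a x‖ := by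
  refine le_of_sq_le_sq ?_ (by positivity)
  rw [mul_pow, PiLp.norm_sq_eq_of_L2 _ (gradFn u x), EuclideanSpace.norm_sq_eq (convect a u x),
    Finset.sum_mul]
  refine Finset.sum_le_sum fun i _ => ?_
  rw [← mul_pow]
  refine pow_le_pow_left₀ (norm_nonneg _) ?_ 2
  rw [mul_comm]
  exact norm_inner_le_norm (a x) (gradOf (u i) x)

lemma aestronglyMeasurable_convect (w u : Vel Ω) :
    AEStronglyMeasurable (convect (velFn w) u) (volume.restrict Ω) :=
  (PiLp.continuous_toLp 2 _).comp_aestronglyMeasurable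
    (aemeasurable_pi_iff.2 fun i => ((aestronglyMeasurable_velFn w).inner
      (Lp.aestronglyMeasurable (gradOf (u i)))).aemeasurable).aestronglyMeasurable

lemma convect_estimate (h : IsEmbeddingConstants Ω l₁ l₂ C) (w u v : Vel Ω) :
    Integrable (fun x => inner ℝ (convect (velFn w) u x) (velFn v x)) (volume.restrict Ω) ∧
    |∫ x in Ω, inner ℝ (convect (velFn w) u x) (velFn v x)| ≤
      gradNorm u * (√l₂ * gradNorm w * (√l₂ * gradNorm v)) := by
  have hw := gradNorm_nonneg w
  have hv := gradNorm_nonneg v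
  refine integrable_and_abs_integral_le₃ (p := 4) (q := 4)
    ((aestronglyMeasurable_convect w u).inner (aestronglyMeasurable_velFn v))
    (aestronglyMeasurable_gradFn u) (aestronglyMeasurable_velFn w) (aestronglyMeasurable_velFn v)
    (Filter.Eventually.of_forall fun x => ?_) (gradNorm_nonneg u) (by positivity) (by positivity)
    (eLpNorm_gradFn_le u) (h.velFn_four w) (h.velFn_four v)
  rw [← mul_assoc]
  exact (abs_real_inner_le_norm _ _).trans
    (mul_le_mul_of_nonneg_right (norm_convect_le _ u x) (norm_nonneg _))

/-- The trilinear form `((w · ∇)u, v)`. -/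
def convectL (h : IsEmbeddingConstants Ω l₁ l₂ C) : Vel Ω →ₗ[ℝ] Vel Ω →ₗ[ℝ] Vel Ω →ₗ[ℝ] ℝ :=
  IsLinearMap.mk₃ (fun w u v => ∫ x in Ω, inner ℝ (convect (velFn w) u x) (velFn v x))
    (fun u v => (aeLinear_velFn.map (T := fun x a =>
        inner ℝ (WithLp.toLp 2 fun i => inner ℝ a (gradOf (u i) x) : Pt d) (velFn v x)) fun x =>
      ⟨fun a b => by simp [PiLp.inner_apply, inner_add_left, mul_add, Finset.sum_add_distrib],
       fun c a => by
        simp [PiLp.inner_apply, inner_smul_left, Finset.mul_sum, mul_left_comm]⟩).isLinearMap_integral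
      fun w => (convect_estimate h w u v).1)
    (fun w v => (aeLinear_gradFn.map (T := fun x G =>
        inner ℝ (WithLp.toLp 2 fun i => inner ℝ (velFn w x) (G i) : Pt d) (velFn v x)) fun x =>
      ⟨fun a b => by simp [PiLp.inner_apply, inner_add_right, mul_add, Finset.sum_add_distrib],
       fun c a => by
        simp [PiLp.inner_apply, inner_smul_right, Finset.mul_sum, mul_left_comm]⟩).isLinearMap_integral
      fun u => (convect_estimate h w u v).1)
    (fun w u => (aeLinear_velFn.map (T := fun x b => inner ℝ (convect (velFn w) u x) b) fun x =>
      ⟨inner_add_right _, fun c b => inner_smul_right _ _ _⟩).isLinearMap_integral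
      fun v => (convect_estimate h w u v).1)

lemma abs_convectL_le (h : IsEmbeddingConstants Ω l₁ l₂ C) (w u v : Vel Ω) :
    |convectL h w u v| ≤ l₂ * gradNorm w * gradNorm u * gradNorm v := by
  refine (convect_estimate h w u v).2.trans (le_of_eq ?_)
  linear_combination (gradNorm u * gradNorm w * gradNorm v) * Real.mul_self_sqrt h.pos₂.le

lemma A1_eq (h : IsEmbeddingConstants Ω l₁ l₂ C) (ζ η Φ : VelCur Ω) :
    A1 ζ η Φ = 1 / 2 * convectL h ζ.1 η.1 Φ.1 - 1 / 2 * convectL h ζ.1 Φ.1 η.1 := rfl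

/-- The form `A₁` as a trilinear map. -/
def A1L (h : IsEmbeddingConstants Ω l₁ l₂ C) :
    VelCur Ω →ₗ[ℝ] VelCur Ω →ₗ[ℝ] VelCur Ω →ₗ[ℝ] ℝ :=
  IsLinearMap.mk₃ A1
    (fun η Φ => ⟨fun x y => by simp [A1_eq h]; ring, fun c x => by simp [A1_eq h]; ring⟩)
    (fun ζ Φ => ⟨fun x y => by simp [A1_eq h]; ring, fun c x => by simp [A1_eq h]; ring⟩)
    (fun ζ η => ⟨fun x y => by simp [A1_eq h]; ring, fun c x => by simp [A1_eq h]; ring⟩)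

lemma abs_A1_le (h : IsEmbeddingConstants Ω l₁ l₂ C) (ζ η Φ : VelCur Ω) :
    |A1 ζ η Φ| ≤ l₂ * norm1 ζ * norm1 η * norm1 Φ := by
  have h1 := abs_le.1 (abs_convectL_le h ζ.1 η.1 Φ.1)
  have h2 := abs_le.1 (abs_convectL_le h ζ.1 Φ.1 η.1)
  have h3 : |A1 ζ η Φ| ≤ l₂ * gradNorm ζ.1 * gradNorm η.1 * gradNorm Φ.1 := by
    rw [A1_eq h, abs_le]
    constructor <;> linarith [mul_right_comm (l₂ * gradNorm ζ.1) (gradNorm η.1) (gradNorm Φ.1)]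
  refine h3.trans ?_
  have := h.pos₂
  have := gradNorm_nonneg ζ.1
  have := gradNorm_nonneg η.1
  have := gradNorm_nonneg Φ.1
  have := norm1_nonneg ζ
  have := norm1_nonneg η
  gcongr <;> exact gradNorm_le_norm1 _

/-! ### Convection of the temperature -/

lemma heatConvect_estimate (h : IsEmbeddingConstants Ω l₁ l₂ C) (u : Vel Ω) (θ r : H10 Ω) :
    Integrable (fun x => inner ℝ (velFn u x) (gradOf θ x) * fnOf r x) (volume.restrict Ω) ∧
    |∫ x in Ω, inner ℝ (velFn u x) (gradOf θ x) * fnOf r x| ≤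
      ‖gradOf θ‖ * (√l₂ * gradNorm u * (√l₂ * ‖gradOf r‖)) := by
  have hu := gradNorm_nonneg u
  refine integrable_and_abs_integral_le₃ (p := 4) (q := 4)
    (((aestronglyMeasurable_velFn u).inner (Lp.aestronglyMeasurable (gradOf θ))).mul
      (Lp.aestronglyMeasurable (fnOf r)))
    (Lp.aestronglyMeasurable (gradOf θ)) (aestronglyMeasurable_velFn u)
    (Lp.aestronglyMeasurable (fnOf r))
    (Filter.Eventually.of_forall fun x => ?_) (norm_nonneg _) (by positivity) (by positivity)
    (eLpNorm_coe_L2 _).le (h.velFn_four u) (h.fnOf_four r)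
  change |inner ℝ (velFn u x) (gradOf θ x) * fnOf r x| ≤ _
  rw [← mul_assoc, abs_mul, mul_comm ‖gradOf θ x‖]
  exact mul_le_mul_of_nonneg_right (abs_real_inner_le_norm _ _) (abs_nonneg _)

/-- The trilinear form `(u · ∇θ, r)`. -/
def heatConvectL (h : IsEmbeddingConstants Ω l₁ l₂ C) :
    Vel Ω →ₗ[ℝ] H10 Ω →ₗ[ℝ] H10 Ω →ₗ[ℝ] ℝ :=
  IsLinearMap.mk₃ (fun u θ r => ∫ x in Ω, inner ℝ (velFn u x) (gradOf θ x) * fnOf r x)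
    (fun θ r => (aeLinear_velFn.map (T := fun x a => inner ℝ a (gradOf θ x) * fnOf r x) fun x =>
      ⟨fun a b => by simp [inner_add_left, add_mul],
       fun c a => by simp [inner_smul_left, mul_assoc]⟩).isLinearMap_integral
      fun u => (heatConvect_estimate h u θ r).1)
    (fun u r => (aeLinear_gradOf.map (T := fun x G => inner ℝ (velFn u x) G * fnOf r x) fun x =>
      ⟨fun a b => by simp [inner_add_right, add_mul],
       fun c a => by simp [inner_smul_right, mul_assoc]⟩).isLinearMap_integral
      fun θ => (heatConvect_estimate h u θ r).1)
    (fun u θ => (aeLinear_fnOf.map (T := fun x b => inner ℝ (velFn u x) (gradOf θ x) * b) fun x =>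
      ⟨mul_add _, fun c b => mul_left_comm _ _ _⟩).isLinearMap_integral
      fun r => (heatConvect_estimate h u θ r).1)

lemma abs_heatConvectL_le (h : IsEmbeddingConstants Ω l₁ l₂ C) (u : Vel Ω) (θ r : H10 Ω) :
    |heatConvectL h u θ r| ≤ l₂ * gradNorm u * ‖gradOf θ‖ * ‖gradOf r‖ := by
  refine (heatConvect_estimate h u θ r).2.trans (le_of_eq ?_)
  linear_combination (gradNorm u * ‖gradOf θ‖ * ‖gradOf r‖) * Real.mul_self_sqrt h.pos₂.le

lemma Hform_eq (h : IsEmbeddingConstants Ω l₁ l₂ C) (η : VelCur Ω) (θ r : H10 Ω) :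
    Hform η θ r = 1 / 2 * heatConvectL h η.1 θ r - 1 / 2 * heatConvectL h η.1 r θ := rfl

/-- The form `H` as a trilinear map. -/
def HformL (h : IsEmbeddingConstants Ω l₁ l₂ C) :
    VelCur Ω →ₗ[ℝ] H10 Ω →ₗ[ℝ] H10 Ω →ₗ[ℝ] ℝ :=
  IsLinearMap.mk₃ Hform
    (fun η Φ => ⟨fun x y => by simp [Hform_eq h]; ring, fun c x => by simp [Hform_eq h]; ring⟩)
    (fun ζ Φ => ⟨fun x y => by simp [Hform_eq h]; ring, fun c x => by simp [Hform_eq h]; ring⟩)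
    (fun ζ η => ⟨fun x y => by simp [Hform_eq h]; ring, fun c x => by simp [Hform_eq h]; ring⟩)

lemma abs_Hform_le (h : IsEmbeddingConstants Ω l₁ l₂ C) (η : VelCur Ω) (θ r : H10 Ω) :
    |Hform η θ r| ≤ l₂ * norm1 η * ‖gradOf θ‖ * ‖gradOf r‖ := by
  have h1 := abs_le.1 (abs_heatConvectL_le h η.1 θ r)
  have h2 := abs_le.1 (abs_heatConvectL_le h η.1 r θ)
  have h3 : |Hform η θ r| ≤ l₂ * gradNorm η.1 * ‖gradOf θ‖ * ‖gradOf r‖ := by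
    rw [Hform_eq h, abs_le]
    constructor <;> linarith [mul_right_comm (l₂ * gradNorm η.1) ‖gradOf θ‖ ‖gradOf r‖]
  refine h3.trans ?_
  have := h.pos₂
  gcongr
  exact gradNorm_le_norm1 _

/-! ### The Lorentz force -/

lemma isLinearMap_pad : IsLinearMap ℝ (pad : Pt d → Fin 3 → ℝ) where
  map_add x y := by ext i; simp only [pad, Pi.add_apply]; split_ifs <;> simp
  map_smul c x := by ext i; simp [pad]

lemma continuous_pad : Continuous (pad : Pt d → Fin 3 → ℝ) := by
  refine continuous_pi fun i => ?_
  unfold pad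
  split_ifs <;> fun_prop

lemma sum_pad_sq (hd : d = 2 ∨ d = 3) (v : Pt d) : ∑ i, pad v i ^ 2 = ‖v‖ ^ 2 := by
  rw [EuclideanSpace.norm_sq_eq]
  rcases hd with rfl | rfl <;> simp [Fin.sum_univ_three, pad, Fin.sum_univ_two]

lemma cross_dot_sq_le (a b c : Fin 3 → ℝ) :
    ((a ⨯₃ b) ⬝ᵥ c) ^ 2 ≤ (∑ i, a i ^ 2) * (∑ i, b i ^ 2) * ∑ i, c i ^ 2 := by
  have h1 : ((a ⨯₃ b) ⬝ᵥ c) ^ 2 ≤ (∑ i, (a ⨯₃ b) i ^ 2) * ∑ i, c i ^ 2 :=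
    Finset.sum_mul_sq_le_sq_mul_sq _ _ _
  refine h1.trans ?_
  gcongr
  simp only [Fin.sum_univ_three, cross_apply, Matrix.cons_val]
  -- Lagrange's identity |a × b|² = |a|²|b|² − (a · b)².
  nlinarith [sq_nonneg (a 0 * b 0 + a 1 * b 1 + a 2 * b 2)]

lemma abs_cross_dot_le (hd : d = 2 ∨ d = 3) (k v : Pt d) (b : Pt 3) :
    |(pad k ⨯₃ b.ofLp) ⬝ᵥ pad v| ≤ ‖k‖ * (‖b‖ * ‖v‖) := by
  refine abs_le_of_sq_le_sq ?_ (by positivity)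
  refine (cross_dot_sq_le _ _ _).trans (le_of_eq ?_)
  rw [sum_pad_sq hd, sum_pad_sq hd, mul_pow, mul_pow, EuclideanSpace.norm_sq_eq b]
  simp only [Real.norm_eq_abs, sq_abs]
  ring

lemma aestronglyMeasurable_lorentz (B : Lp (Pt 3) 3 (volume.restrict Ω)) (K : H0div Ω)
    (v : Vel Ω) : AEStronglyMeasurable (fun x =>
      ((pad (fieldOf K x)) ⨯₃ (B x).ofLp) ⬝ᵥ pad (velFn v x)) (volume.restrict Ω) := by
  have hK : ∀ i, AEStronglyMeasurable (fun x => pad (fieldOf K x) i) (volume.restrict Ω) :=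
    fun i => ((continuous_apply i).comp continuous_pad).comp_aestronglyMeasurable
      (Lp.aestronglyMeasurable (fieldOf K))
  have hB : ∀ i, AEStronglyMeasurable (fun x => B x i) (volume.restrict Ω) := fun i =>
    (PiLp.continuous_apply 2 _ i).comp_aestronglyMeasurable (Lp.aestronglyMeasurable B)
  have hv : ∀ i, AEStronglyMeasurable (fun x => pad (velFn v x) i) (volume.restrict Ω) :=
    fun i => ((continuous_apply i).comp continuous_pad).comp_aestronglyMeasurable
      (aestronglyMeasurable_velFn v)
  simp only [cross_apply, dotProduct, Fin.sum_univ_three, Matrix.cons_val]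
  exact (((((hK 1).mul (hB 2)).sub ((hK 2).mul (hB 1))).mul (hv 0)).add
    ((((hK 2).mul (hB 0)).sub ((hK 0).mul (hB 2))).mul (hv 1))).add
    ((((hK 0).mul (hB 1)).sub ((hK 1).mul (hB 0))).mul (hv 2))

lemma lorentz_estimate (hd : d = 2 ∨ d = 3) (h : IsEmbeddingConstants Ω l₁ l₂ C)
    (B : Lp (Pt 3) 3 (volume.restrict Ω)) (K : H0div Ω) (v : Vel Ω) :
    Integrable (fun x => ((pad (fieldOf K x)) ⨯₃ (B x).ofLp) ⬝ᵥ pad (velFn v x))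
      (volume.restrict Ω) ∧
    |∫ x in Ω, ((pad (fieldOf K x)) ⨯₃ (B x).ofLp) ⬝ᵥ pad (velFn v x)| ≤
      ‖fieldOf K‖ * (‖B‖ * (l₁ * gradNorm v)) := by
  refine integrable_and_abs_integral_le₃ (p := 3) (q := 6) (aestronglyMeasurable_lorentz B K v)
    (Lp.aestronglyMeasurable (fieldOf K)) (Lp.aestronglyMeasurable B) (aestronglyMeasurable_velFn v)
    (Filter.Eventually.of_forall fun x => abs_cross_dot_le hd _ _ _) (norm_nonneg _)
    (Lp.norm_def B ▸ ENNReal.toReal_nonneg)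
    (mul_nonneg h.pos₁.le (gradNorm_nonneg v)) (eLpNorm_coe_L2 _).le ?_ (h.vel_six v)
  rw [Lp.norm_def, ENNReal.ofReal_toReal (Lp.eLpNorm_ne_top _)]

/-- The bilinear form `(K × B, v)`. -/
def lorentzL (hd : d = 2 ∨ d = 3) (h : IsEmbeddingConstants Ω l₁ l₂ C)
    (B : Lp (Pt 3) 3 (volume.restrict Ω)) : H0div Ω →ₗ[ℝ] Vel Ω →ₗ[ℝ] ℝ :=
  IsLinearMap.mk₂
    (fun K v => ∫ x in Ω, ((pad (fieldOf K x)) ⨯₃ (B x).ofLp) ⬝ᵥ pad (velFn v x))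
    (fun v => (aeLinear_fieldOf.map (T := fun x k => (pad k ⨯₃ (B x).ofLp) ⬝ᵥ pad (velFn v x))
      fun x => ⟨fun a b => by simp [isLinearMap_pad.map_add, add_dotProduct],
        fun c a => by simp [isLinearMap_pad.map_smul, smul_dotProduct]⟩).isLinearMap_integral
      fun K => (lorentz_estimate hd h B K v).1)
    (fun K => (aeLinear_velFn.map (T := fun x b => (pad (fieldOf K x) ⨯₃ (B x).ofLp) ⬝ᵥ pad b)
      fun x => ⟨fun a b => by simp [isLinearMap_pad.map_add, dotProduct_add],
        fun c a => by simp [isLinearMap_pad.map_smul, dotProduct_smul]⟩).isLinearMap_integral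
      fun v => (lorentz_estimate hd h B K v).1)

lemma lorentzL_apply (hd : d = 2 ∨ d = 3) (h : IsEmbeddingConstants Ω l₁ l₂ C)
    (B : Lp (Pt 3) 3 (volume.restrict Ω)) (K : H0div Ω) (v : Vel Ω) :
    lorentzL hd h B K v = ∫ x in Ω, ((pad (fieldOf K x)) ⨯₃ (B x).ofLp) ⬝ᵥ pad (velFn v x) := rfl

attribute [irreducible] lorentzL

/-! ### Divergence and buoyancy -/

lemma memLp_gradOf_apply (r : H10 Ω) (i : Fin d) :
    MemLp (fun x => gradOf r x i) 2 (volume.restrict Ω) :=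
  (Lp.memLp (gradOf r)).of_le
    ((PiLp.continuous_apply 2 _ i).comp_aestronglyMeasurable (Lp.aestronglyMeasurable (gradOf r)))
    (Filter.Eventually.of_forall fun _ => PiLp.norm_apply_le _ i)

lemma integrable_mul_velDiv (q : L2 Ω ℝ) (v : Vel Ω) :
    Integrable (fun x => q x * velDiv v x) (volume.restrict Ω) := by
  simp only [velDiv, Finset.mul_sum]
  exact integrable_finsetSum _ fun i _ => (Lp.memLp q).integrable_mul (memLp_gradOf_apply (v i) i)

/-- The bilinear form `(q, ∇ · v)`. -/
def velDivL (Ω : Set (Pt d)) : L2 Ω ℝ →ₗ[ℝ] Vel Ω →ₗ[ℝ] ℝ :=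
  IsLinearMap.mk₂ (fun q v => ∫ x in Ω, q x * velDiv v x)
    (fun v => (aeLinear_coeFn.map (T := fun x b => b * velDiv v x) fun _ =>
      ⟨fun a b => add_mul _ _ _, fun c a => mul_assoc _ _ _⟩).isLinearMap_integral
      fun q => integrable_mul_velDiv q v)
    (fun q => (aeLinear_gradFn.map (T := fun x G => q x * ∑ i, G i i) fun x =>
      ⟨fun a b => by simp [Finset.sum_add_distrib, mul_add],
        fun c a => by simp [← Finset.mul_sum, mul_left_comm]⟩).isLinearMap_integral
      fun v => integrable_mul_velDiv q v)

/-- Cauchy–Schwarz with the Poincaré inequality for both factors, whence the `C ^ 2` in `lamQ`. -/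
lemma buoyancy_estimate (h : IsEmbeddingConstants Ω l₁ l₂ C) {n : Pt d} (hn : ‖n‖ = 1)
    (θ : H10 Ω) (v : Vel Ω) :
    Integrable (fun x => fnOf θ x * inner ℝ n (velFn v x)) (volume.restrict Ω) ∧
    |∫ x in Ω, fnOf θ x * inner ℝ n (velFn v x)| ≤ C * ‖gradOf θ‖ * (C * gradNorm v) := by
  have hC := h.pos
  refine integrable_and_abs_integral_le₂
    ((Lp.aestronglyMeasurable (fnOf θ)).mul
      (aestronglyMeasurable_const.inner (aestronglyMeasurable_velFn v)))
    (Lp.aestronglyMeasurable (fnOf θ)) (aestronglyMeasurable_velFn v)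
    (Filter.Eventually.of_forall fun x => ?_) (by positivity)
    (mul_nonneg hC.le (gradNorm_nonneg v)) (h.scalar_two θ) (h.vel_two v)
  change |fnOf θ x * inner ℝ n (velFn v x)| ≤ _
  rw [abs_mul]
  refine mul_le_mul_of_nonneg_left ?_ (abs_nonneg _)
  simpa [hn] using abs_real_inner_le_norm n (velFn v x)

/-- The bilinear form `(θ n, v)`. -/
def buoyancyL (h : IsEmbeddingConstants Ω l₁ l₂ C) {n : Pt d} (hn : ‖n‖ = 1) :
    H10 Ω →ₗ[ℝ] Vel Ω →ₗ[ℝ] ℝ :=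
  IsLinearMap.mk₂ (fun θ v => ∫ x in Ω, fnOf θ x * inner ℝ n (velFn v x))
    (fun v => (aeLinear_fnOf.map (T := fun x b => b * inner ℝ n (velFn v x)) fun x =>
      ⟨fun a b => add_mul _ _ _, fun c a => mul_assoc _ _ _⟩).isLinearMap_integral
      fun θ => (buoyancy_estimate h hn θ v).1)
    (fun θ => (aeLinear_velFn.map (T := fun x b => fnOf θ x * inner ℝ n b) fun x =>
      ⟨fun a b => by simp [inner_add_right, mul_add],
        fun c a => by simp [inner_smul_right, mul_left_comm]⟩).isLinearMap_integral
      fun v => (buoyancy_estimate h hn θ v).1)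

end ThermalMHD

end

/-! ### Verification of the abstract assumptions -/

noncomputable section

namespace ThermalMHD

open scoped NNReal ENNReal

variable {d : ℕ} {Ω : Set (Pt d)} {l₁ l₂ C : ℝ}

/-! ### The norms as seminorms -/

/-- The gradient of a velocity as an element of a Hilbert space. -/
def velGradL (Ω : Set (Pt d)) : Vel Ω →ₗ[ℝ] PiLp 2 fun _ : Fin d => L2 Ω (Pt d) where
  toFun v := WithLp.toLp 2 fun i => gradL Ω (v i)
  map_add' _ _ := rfl
  map_smul' _ _ := rfl

lemma norm_velGradL (v : Vel Ω) : ‖velGradL Ω v‖ = gradNorm v :=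
  PiLp.norm_eq_of_L2 _

/-- The bilinear form `(∇v, ∇w)`. -/
def velInnerL (Ω : Set (Pt d)) : Vel Ω →ₗ[ℝ] Vel Ω →ₗ[ℝ] ℝ :=
  (innerₗ _).compl₁₂ (velGradL Ω) (velGradL Ω)

lemma velInnerL_apply (v w : Vel Ω) :
    velInnerL Ω v w = ∑ i, inner ℝ (gradOf (v i)) (gradOf (w i)) :=
  PiLp.inner_apply (velGradL Ω v) (velGradL Ω w)

lemma velInnerL_self (v : Vel Ω) : velInnerL Ω v v = gradNorm v ^ 2 := by
  rw [← norm_velGradL]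
  exact real_inner_self_eq_norm_sq (velGradL Ω v)

lemma abs_velInnerL_le (v w : Vel Ω) : |velInnerL Ω v w| ≤ gradNorm v * gradNorm w := by
  rw [← norm_velGradL, ← norm_velGradL]
  exact abs_real_inner_le_norm (velGradL Ω v) (velGradL Ω w)

/-- The bilinear form `(J, K)`. -/
def fieldInnerL (Ω : Set (Pt d)) : H0div Ω →ₗ[ℝ] H0div Ω →ₗ[ℝ] ℝ :=
  (innerₗ _).compl₁₂ (fieldL Ω) (fieldL Ω)

lemma fieldInnerL_self (K : H0div Ω) : fieldInnerL Ω K K = ‖fieldOf K‖ ^ 2 :=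
  real_inner_self_eq_norm_sq (fieldL Ω K)

lemma abs_fieldInnerL_le (J K : H0div Ω) : |fieldInnerL Ω J K| ≤ ‖fieldOf J‖ * ‖fieldOf K‖ :=
  abs_real_inner_le_norm (fieldL Ω J) (fieldL Ω K)

lemma fieldInnerL_apply (J K : H0div Ω) :
    fieldInnerL Ω J K = inner ℝ (fieldOf J) (fieldOf K) := rfl

attribute [irreducible] velInnerL fieldInnerL

/-- The gradient of the velocity, the current density and its divergence as an element of a
Hilbert space. -/
def graphL (Ω : Set (Pt d)) : VelCur Ω →ₗ[ℝ] WithLp 2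
    ((PiLp 2 fun _ : Fin d => L2 Ω (Pt d)) × WithLp 2 (L2 Ω (Pt d) × L2 Ω ℝ)) where
  toFun η := WithLp.toLp 2 (velGradL Ω η.1, WithLp.toLp 2 (fieldL Ω η.2, divL Ω η.2))
  map_add' _ _ := rfl
  map_smul' _ _ := rfl

/-- Realising `norm1` as a Hilbert space norm composed with a linear map yields its triangle
inequality and homogeneity. -/
lemma norm_graphL (η : VelCur Ω) : ‖graphL Ω η‖ = norm1 η := by
  rw [← sq_eq_sq₀ (norm_nonneg _) (norm1_nonneg η), norm1_sq, WithLp.prod_norm_sq_eq_of_L2,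
    divNorm_sq]
  have h1 : ‖(graphL Ω η).snd‖ ^ 2 = ‖fieldOf η.2‖ ^ 2 + ‖divOf η.2‖ ^ 2 :=
    WithLp.prod_norm_sq_eq_of_L2 _
  have h2 : ‖(graphL Ω η).fst‖ = gradNorm η.1 := norm_velGradL η.1
  rw [h1, h2]

/-- The norm of `D` as a seminorm. -/
def norm1Semi (Ω : Set (Pt d)) : Seminorm ℝ (VelCur Ω) :=
  Seminorm.of norm1
    (fun x y => by
      simp only [← norm_graphL, map_add]
      exact norm_add_le _ _)
    (fun c x => by
      simp only [← norm_graphL, map_smul]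
      exact norm_smul _ _)

lemma divNorm_le_norm1 (η : VelCur Ω) : divNorm η.2 ≤ norm1 η :=
  Real.le_sqrt_of_sq_le (by linarith [sq_nonneg (gradNorm η.1)])

lemma IsEmbeddingConstants.eq_zero_of_norm1 (h : IsEmbeddingConstants Ω l₁ l₂ C) {η : VelCur Ω}
    (hη : norm1 η = 0) : η = 0 := by
  have h1 : gradNorm η.1 = 0 :=
    le_antisymm (hη ▸ gradNorm_le_norm1 η) (gradNorm_nonneg _)
  have h2 : divNorm η.2 = 0 := le_antisymm (hη ▸ divNorm_le_norm1 η) (divNorm_nonneg _)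
  have h3 : ‖fieldOf η.2‖ ^ 2 + ‖divOf η.2‖ ^ 2 = 0 := by rw [← divNorm_sq, h2]; norm_num
  have h4 : fieldOf η.2 = 0 := norm_eq_zero.1 (pow_eq_zero_iff two_ne_zero |>.1
    (le_antisymm (by linarith [sq_nonneg ‖divOf η.2‖]) (sq_nonneg _)))
  have h5 : divOf η.2 = 0 := norm_eq_zero.1 (pow_eq_zero_iff two_ne_zero |>.1
    (le_antisymm (by linarith [sq_nonneg ‖fieldOf η.2‖]) (sq_nonneg _)))
  exact Prod.ext (h.eq_zero_of_gradNorm h1) (Subtype.ext (Prod.ext h4 h5))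

lemma norm0_sq (ξ : PrePot Ω) : norm0 ξ ^ 2 = ‖ξ.1‖ ^ 2 + ‖ξ.2‖ ^ 2 :=
  Real.sq_sqrt (by positivity)

lemma eq_zero_of_norm0 {ξ : PrePot Ω} (hξ : norm0 ξ ≤ 0) : ξ = 0 := by
  have h0 : norm0 ξ = 0 := le_antisymm hξ (Real.sqrt_nonneg _)
  have h1 : ‖ξ.1‖ ^ 2 + ‖ξ.2‖ ^ 2 = 0 := by rw [← norm0_sq, h0]; norm_num
  exact Prod.ext
    (norm_eq_zero.1 (pow_eq_zero_iff two_ne_zero |>.1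
      (le_antisymm (by linarith [sq_nonneg ‖ξ.2‖]) (sq_nonneg _))))
    (norm_eq_zero.1 (pow_eq_zero_iff two_ne_zero |>.1
      (le_antisymm (by linarith [sq_nonneg ‖ξ.1‖]) (sq_nonneg _))))

lemma add_mul_le_sqrt_mul_sqrt (x y a b : ℝ) :
    x * a + y * b ≤ √(x ^ 2 + y ^ 2) * √(a ^ 2 + b ^ 2) := by
  rw [← Real.sqrt_mul (by positivity)]
  exact Real.le_sqrt_of_sq_le (by nlinarith [sq_nonneg (x * b - y * a)])

/-- Used once for each argument of `A₀`; the two factors √2 make up the 2 in `Cmax`. -/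
lemma gradNorm_add_norm_fieldOf_le (η : VelCur Ω) :
    gradNorm η.1 + ‖fieldOf η.2‖ ≤ √2 * norm1 η := by
  have aux : ∀ a b c : ℝ, (a + b) ^ 2 ≤ 2 * (a ^ 2 + (b ^ 2 + c ^ 2)) := fun a b c => by
    nlinarith [sq_nonneg (a - b), sq_nonneg c]
  refine le_of_sq_le_sq ?_ (mul_nonneg (Real.sqrt_nonneg _) (norm1_nonneg η))
  rw [mul_pow, Real.sq_sqrt zero_le_two, norm1_sq, divNorm_sq]
  exact aux _ _ _

/-! ### The forms as linear maps -/

namespace Data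

variable (P : Data Ω)

lemma coupling_eq (hd : d = 2 ∨ d = 3) (h : IsEmbeddingConstants Ω l₁ l₂ C) (K : H0div Ω)
    (v : Vel Ω) : P.coupling K v = -P.kappa * lorentzL hd h P.B K v := by
  rw [lorentzL_apply, coupling]

lemma A0_eq (hd : d = 2 ∨ d = 3) (h : IsEmbeddingConstants Ω l₁ l₂ C) (η Φ : VelCur Ω) :
    P.A0 η Φ = P.Pr * velInnerL Ω η.1 Φ.1 + P.kappa * fieldInnerL Ω η.2 Φ.2
      + -P.kappa * lorentzL hd h P.B η.2 Φ.1 - -P.kappa * lorentzL hd h P.B Φ.2 η.1 := by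
  have aux : ∀ {p q a a' b b' c c' e e' : ℝ}, a = a' → b = b' → c = c' → e = e' →
      p * a + q * b + c - e = p * a' + q * b' + c' - e' := by
    rintro p q a _ b _ c _ e _ rfl rfl rfl rfl; rfl
  exact aux (velInnerL_apply η.1 Φ.1).symm (fieldInnerL_apply η.2 Φ.2).symm
    (P.coupling_eq hd h η.2 Φ.1) (P.coupling_eq hd h Φ.2 η.1)

/-- The form `A₀` as a bilinear map. -/
def A0L (hd : d = 2 ∨ d = 3) (h : IsEmbeddingConstants Ω l₁ l₂ C) :
    VelCur Ω →ₗ[ℝ] VelCur Ω →ₗ[ℝ] ℝ :=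
  P.Pr • (velInnerL Ω).compl₁₂ (LinearMap.fst ℝ _ _) (LinearMap.fst ℝ _ _)
    + P.kappa • (fieldInnerL Ω).compl₁₂ (LinearMap.snd ℝ _ _) (LinearMap.snd ℝ _ _)
    + -P.kappa • (lorentzL hd h P.B).compl₁₂ (LinearMap.snd ℝ _ _) (LinearMap.fst ℝ _ _)
    - -P.kappa • (lorentzL hd h P.B).flip.compl₁₂ (LinearMap.fst ℝ _ _) (LinearMap.snd ℝ _ _)

lemma A0L_apply (hd : d = 2 ∨ d = 3) (h : IsEmbeddingConstants Ω l₁ l₂ C) (η Φ : VelCur Ω) :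
    P.A0L hd h η Φ = P.A0 η Φ :=
  (P.A0_eq hd h η Φ).symm

lemma Cmax_nonneg (hPr : 0 < P.Pr) (l₁ : ℝ) : 0 ≤ P.Cmax l₁ :=
  mul_nonneg zero_le_two (hPr.le.trans (le_max_left _ _))

lemma Cmin_pos (hPr : 0 < P.Pr) (hκ : 0 < P.kappa) : 0 < P.Cmin := lt_min hPr hκ

lemma abs_coupling_le (hd : d = 2 ∨ d = 3) (h : IsEmbeddingConstants Ω l₁ l₂ C)
    (hκ : 0 < P.kappa) (K : H0div Ω) (v : Vel Ω) :
    |-P.kappa * lorentzL hd h P.B K v| ≤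
      P.kappa * l₁ * ‖P.B‖ * (‖fieldOf K‖ * gradNorm v) := by
  have h1 : |lorentzL hd h P.B K v| ≤ ‖fieldOf K‖ * (‖P.B‖ * (l₁ * gradNorm v)) :=
    lorentzL_apply hd h P.B K v ▸ (lorentz_estimate hd h P.B K v).2
  refine (abs_mul _ _).trans_le (((abs_neg P.kappa).trans (abs_of_pos hκ)).symm ▸
    (mul_le_mul_of_nonneg_left h1 hκ.le).trans (le_of_eq ?_))
  ring

lemma abs_mul_le_mul_of_abs_le {p M x y : ℝ} (hp : 0 ≤ p) (h : p ≤ M) (hx : |x| ≤ y) :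
    |p * x| ≤ M * y := by
  rw [abs_mul, abs_of_nonneg hp]
  exact mul_le_mul h hx (abs_nonneg _) (hp.trans h)

lemma abs_A0_le (hd : d = 2 ∨ d = 3) (h : IsEmbeddingConstants Ω l₁ l₂ C) (hPr : 0 < P.Pr)
    (hκ : 0 < P.kappa) (η Φ : VelCur Ω) : |P.A0 η Φ| ≤ P.Cmax l₁ * norm1 η * norm1 Φ := by
  set M := max P.Pr (max P.kappa (P.kappa * l₁ * ‖P.B‖)) with hM
  have hM0 : 0 ≤ M := hPr.le.trans (le_max_left _ _)
  have e1 : P.Pr ≤ M := le_max_left _ _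
  have e2 : P.kappa ≤ M := (le_max_left _ _).trans (le_max_right _ _)
  have e3 : P.kappa * l₁ * ‖P.B‖ ≤ M := (le_max_right _ _).trans (le_max_right _ _)
  have ha := gradNorm_nonneg η.1
  have hb := gradNorm_nonneg Φ.1
  have hc := norm_nonneg (fieldOf η.2)
  have hf := norm_nonneg (fieldOf Φ.2)
  have b1 := abs_mul_le_mul_of_abs_le hPr.le e1 (abs_velInnerL_le η.1 Φ.1)
  have b2 := abs_mul_le_mul_of_abs_le hκ.le e2 (abs_fieldInnerL_le η.2 Φ.2)
  have b3 := fun K v => (P.abs_coupling_le hd h hκ K v).trans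
    (mul_le_mul_of_nonneg_right e3 (mul_nonneg (norm_nonneg (fieldOf K)) (gradNorm_nonneg v)))
  have b4 := b3 η.2 Φ.1
  have b5 := b3 Φ.2 η.1
  -- The four terms of `A₀` are bounded by `M` times the four products that arise on expanding the
  -- right-hand side.
  have hsum : |P.A0 η Φ| ≤
      M * ((gradNorm η.1 + ‖fieldOf η.2‖) * (gradNorm Φ.1 + ‖fieldOf Φ.2‖)) := by
    have aux : ∀ {x y z w a b c e : ℝ}, |x| ≤ M * (a * b) → |y| ≤ M * (c * e) →
        |z| ≤ M * (c * b) → |w| ≤ M * (e * a) → |x + y + z - w| ≤ M * ((a + c) * (b + e)) := by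
      intro x y z w a b c e h1 h2 h3 h4
      rw [abs_le] at *
      constructor <;> linarith
    exact (congrArg abs (P.A0_eq hd h η Φ)).trans_le (aux b1 b2 b4 b5)
  have hn1 := norm1_nonneg η
  calc |P.A0 η Φ| ≤ _ := hsum
    _ ≤ M * ((√2 * norm1 η) * (√2 * norm1 Φ)) := by
      gcongr
      · exact gradNorm_add_norm_fieldOf_le η
      · exact gradNorm_add_norm_fieldOf_le Φ
    _ = P.Cmax l₁ * norm1 η * norm1 Φ := by
      rw [Cmax, ← hM]
      linear_combination (M * norm1 η * norm1 Φ) * Real.mul_self_sqrt (zero_le_two (α := ℝ))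

/-- On the diagonal the two Lorentz terms cancel, and for a divergence-free current the div-norm
reduces to the L² norm. -/
lemma A0_coercive (hd : d = 2 ∨ d = 3) (h : IsEmbeddingConstants Ω l₁ l₂ C) {η : VelCur Ω}
    (hη : divOf η.2 = 0) : P.Cmin * norm1 η ^ 2 ≤ P.A0 η η := by
  have e1 : P.A0 η η = P.Pr * gradNorm η.1 ^ 2 + P.kappa * ‖fieldOf η.2‖ ^ 2 := by
    have aux : ∀ {p q x x' y y' z : ℝ}, x = x' → y = y' →
        p * x + q * y + z - z = p * x' + q * y' := by
      rintro p q x _ y _ z rfl rfl; ring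
    exact (P.A0_eq hd h η η).trans (aux (velInnerL_self η.1) (fieldInnerL_self η.2))
  have e2 : ‖divOf η.2‖ = 0 := by rw [hη, norm_zero]
  rw [e1, norm1_sq, divNorm_sq, e2]
  have h1 : P.Cmin * gradNorm η.1 ^ 2 ≤ P.Pr * gradNorm η.1 ^ 2 :=
    mul_le_mul_of_nonneg_right (min_le_left _ _) (sq_nonneg _)
  have h2 : P.Cmin * ‖fieldOf η.2‖ ^ 2 ≤ P.kappa * ‖fieldOf η.2‖ ^ 2 :=
    mul_le_mul_of_nonneg_right (min_le_right _ _) (sq_nonneg _)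
  linarith

/-- The form `b_s` as a bilinear map. -/
def bsL : L20 Ω →ₗ[ℝ] Vel Ω →ₗ[ℝ] ℝ := -P.Pr • (velDivL Ω ∘ₗ (L20 Ω).subtype)

/-- The form `b_m` as a bilinear map. -/
def bmL : L20 Ω →ₗ[ℝ] H0div Ω →ₗ[ℝ] ℝ :=
  -P.kappa • ((innerₗ (L2 Ω ℝ)).compl₁₂ (L20 Ω).subtype (divL Ω))

/-- The form `B` as a bilinear map. -/
def BformL : PrePot Ω →ₗ[ℝ] VelCur Ω →ₗ[ℝ] ℝ :=
  P.bsL.compl₁₂ (LinearMap.fst ℝ _ _) (LinearMap.fst ℝ _ _)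
    + P.bmL.compl₁₂ (LinearMap.snd ℝ _ _) (LinearMap.snd ℝ _ _)

/-- The form `Q` as a bilinear map. -/
def QL (h : IsEmbeddingConstants Ω l₁ l₂ C) (hn : ‖P.dir‖ = 1) :
    H10 Ω →ₗ[ℝ] VelCur Ω →ₗ[ℝ] ℝ :=
  -(P.Pr * P.Ra) • (buoyancyL h hn).compl₁₂ LinearMap.id (LinearMap.fst ℝ _ _)

lemma abs_Q_le (h : IsEmbeddingConstants Ω l₁ l₂ C) (hn : ‖P.dir‖ = 1) (hPr : 0 < P.Pr)
    (hRa : 0 ≤ P.Ra) (θ : H10 Ω) (Φ : VelCur Ω) :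
    |P.Q θ Φ| ≤ P.lamQ C * ‖gradOf θ‖ * norm1 Φ := by
  have h1 := (buoyancy_estimate h hn θ Φ.1).2
  have h2 := gradNorm_le_norm1 Φ
  have hpr : 0 ≤ P.Pr * P.Ra := mul_nonneg hPr.le hRa
  have hC := h.pos
  rw [Q, abs_mul, abs_neg, abs_of_nonneg hpr]
  calc P.Pr * P.Ra * _ ≤ P.Pr * P.Ra * (C * ‖gradOf θ‖ * (C * norm1 Φ)) := by
        refine mul_le_mul_of_nonneg_left (h1.trans ?_) hpr
        gcongr
    _ = _ := by rw [lamQ]; ring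

/-- The load as a linear map. -/
def loadL : VelCur Ω →ₗ[ℝ] ℝ :=
  P.f.toLinearMap ∘ₗ LinearMap.fst ℝ _ _
    + P.kappa • (innerₗ (L2 Ω (Pt d)) P.g ∘ₗ fieldL Ω ∘ₗ LinearMap.snd ℝ _ _)

lemma load_le (h : IsEmbeddingConstants Ω l₁ l₂ C) (hκ : 0 < P.kappa) (Φ : VelCur Ω) :
    P.load Φ ≤ P.normL * norm1 Φ := by
  have h1 := h.le_dualNormVel_mul P.f Φ.1
  have h2 : P.kappa * inner ℝ P.g (fieldOf Φ.2) ≤ P.kappa * ‖P.g‖ * divNorm Φ.2 := by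
    rw [mul_assoc]
    refine mul_le_mul_of_nonneg_left ((real_inner_le_norm _ _).trans ?_) hκ.le
    exact mul_le_mul_of_nonneg_left (norm_fieldOf_le_divNorm _) (norm_nonneg _)
  have h3 := add_mul_le_sqrt_mul_sqrt (dualNormVel P.f) (P.kappa * ‖P.g‖) (gradNorm Φ.1)
    (divNorm Φ.2)
  rw [mul_pow] at h3
  exact (add_le_add h1 h2).trans h3

end Data

/-! ### The inf-sup condition for the product space -/

/-- An upper bound for a functional on a subspace that depends on the norm of the argument only
bounds the supremum of the functional over the sphere of radius `s`. -/
lemma mul_le_of_le_iSup {V : Type*} [AddCommGroup V] [Module ℝ V] (S : Submodule ℝ V) (N : V → ℝ)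
    (hN : ∀ (c : ℝ) v, N (c • v) = |c| * N v) (hpos : ∀ v, v ≠ 0 → 0 < N v) (ℓ : V →ₗ[ℝ] ℝ)
    {β n : ℝ} (hβ : 0 < β) (hn : 0 ≤ n)
    (hsup : n ≠ 0 → β ≤ ⨆ v : {v : V // v ∈ S ∧ v ≠ 0}, ℓ v.1 / (N v.1 * n)) {M : ℝ → ℝ} {a : ℝ}
    (hM : ∀ s, 0 ≤ s → M 0 ≤ M s) (h : ∀ v ∈ S, ℓ v + a ≤ M (N v)) {s : ℝ} (hs : 0 ≤ s) :
    s * (β * n) + a ≤ M s := by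
  have h0 : a ≤ M s := by
    have h1 := h 0 S.zero_mem
    have h2 : N 0 = 0 := by simpa using hN 0 0
    rw [map_zero, zero_add, h2] at h1
    exact h1.trans (hM s hs)
  rcases hn.eq_or_lt with rfl | hn'
  · simpa using h0
  rcases hs.eq_or_lt with rfl | hs'
  · simpa using h0
  -- Over an empty index type the supremum would be 0, contradicting `0 < β`.
  have hne : Nonempty {v : V // v ∈ S ∧ v ≠ 0} := by
    by_contra hemp
    rw [not_nonempty_iff] at hemp
    have := hsup hn'.ne'
    rw [Real.iSup_of_isEmpty] at this
    linarith
  have hle : β ≤ (M s - a) / (s * n) := by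
    refine (hsup hn'.ne').trans (ciSup_le fun v => ?_)
    have hv := hpos v.1 v.2.2
    -- Rescaling `v` to norm `s` turns the hypothesis into a bound for the homogeneous quotient.
    have h1 := h ((s / N v.1) • v.1) (S.smul_mem _ v.2.1)
    rw [hN, abs_of_pos (by positivity), div_mul_cancel₀ _ hv.ne', map_smul, smul_eq_mul] at h1
    rw [div_le_div_iff₀ (by positivity) (by positivity)]
    have h2 : s / N v.1 * ℓ v.1 ≤ M s - a := by linarith
    rw [div_mul_eq_mul_div, div_le_iff₀ hv] at h2
    calc ℓ v.1 * (s * n) = s * ℓ v.1 * n := by ring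
      _ ≤ (M s - a) * N v.1 * n := by gcongr
      _ = _ := by ring
  rw [le_div_iff₀ (by positivity)] at hle
  linarith

lemma gradNorm_smul (c : ℝ) (v : Vel Ω) : gradNorm (c • v) = |c| * gradNorm v := by
  rw [← norm_velGradL, map_smul, norm_smul, norm_velGradL, Real.norm_eq_abs]

lemma norm1_zero_left (K : H0div Ω) : norm1 ((0 : Vel Ω), K) = divNorm K := by
  have h : gradNorm (0 : Vel Ω) = 0 := by rw [← norm_velGradL, map_zero, norm_zero]
  rw [norm1, h]
  simp [Real.sqrt_sq (divNorm_nonneg K)]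

lemma divNorm_smul (c : ℝ) (K : H0div Ω) : divNorm (c • K) = |c| * divNorm K := by
  have h1 : norm1 (c • ((0 : Vel Ω), K)) = |c| * norm1 ((0 : Vel Ω), K) := by
    rw [← norm_graphL, map_smul, norm_smul, norm_graphL, Real.norm_eq_abs]
  rw [Prod.smul_mk, smul_zero, norm1_zero_left, norm1_zero_left] at h1
  exact h1

/-- Put x = βs‖q‖ and y = βm‖ψ‖. Taking the supremum over velocities of norm `s` with `K` fixed,
then over currents of norm `t`, gives t y + s x ≤ R √(t² + s²) for all s, t ≥ 0. No maximiser is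
needed. -/
lemma FESpaces.InfSup.min_mul_norm0_le (h : IsEmbeddingConstants Ω l₁ l₂ C) {F : FESpaces Ω}
    {P : Data Ω} {βs βm : ℝ} (hF : F.InfSup P βs βm) (hs : 0 < βs) (hm : 0 < βm) {χ : PrePot Ω}
    (hχ : χ ∈ F.G) {R : ℝ} (hR : 0 ≤ R) (hB : ∀ Φ ∈ F.D, P.Bform χ Φ ≤ R * norm1 Φ) :
    min βs βm * norm0 χ ≤ R := by
  have hmono : ∀ {x y : ℝ}, 0 ≤ x → 0 ≤ y → ∀ z : ℝ,
      R * √(0 ^ 2 + z ^ 2) ≤ R * √(x ^ 2 + z ^ 2) := fun {x y} hx hy z =>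
    mul_le_mul_of_nonneg_left (Real.sqrt_le_sqrt (by nlinarith [sq_nonneg x])) hR
  have h1 : ∀ K ∈ F.Y, ∀ s, 0 ≤ s →
      s * (βs * ‖χ.1‖) + P.bm χ.2 K ≤ R * √(s ^ 2 + divNorm K ^ 2) := fun K hK s hs' =>
    mul_le_of_le_iSup F.X gradNorm gradNorm_smul
      (fun v hv => (gradNorm_nonneg v).lt_of_ne' fun h0 => hv (h.eq_zero_of_gradNorm h0))
      (P.bsL χ.1) hs (norm_nonneg _) (fun hn => hF.hydro χ.1 hχ.1 (norm_ne_zero_iff.1 hn))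
      (M := fun t => R * √(t ^ 2 + divNorm K ^ 2)) (fun t ht => hmono ht le_rfl _)
      (fun v hv => hB (v, K) ⟨hv, hK⟩) hs'
  have h2 : ∀ s, 0 ≤ s → ∀ t, 0 ≤ t →
      t * (βm * ‖χ.2‖) + s * (βs * ‖χ.1‖) ≤ R * √(t ^ 2 + s ^ 2) := fun s hs' t ht =>
    mul_le_of_le_iSup F.Y divNorm divNorm_smul
      (fun K hK => by
        refine (divNorm_nonneg K).lt_of_ne' fun h0 => hK ?_
        have := h.eq_zero_of_norm1 (η := (0, K)) (by rw [norm1_zero_left, h0])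
        exact congrArg Prod.snd this)
      (P.bmL χ.2) hm (norm_nonneg _) (fun hn => hF.electric χ.2 hχ.2 (norm_ne_zero_iff.1 hn))
      (M := fun t => R * √(t ^ 2 + s ^ 2)) (fun t ht => hmono ht le_rfl _)
      (fun K hK => by
        have := h1 K hK s hs'
        rw [add_comm, add_comm (divNorm K ^ 2)]
        exact this) ht
  -- The optimal radii s = x, t = y turn the inequality into T² ≤ R T with T = √(x² + y²).
  have h3 := h2 (βs * ‖χ.1‖) (by positivity) (βm * ‖χ.2‖) (by positivity)
  set T := √((βm * ‖χ.2‖) ^ 2 + (βs * ‖χ.1‖) ^ 2) with hT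
  have hT0 : 0 ≤ T := Real.sqrt_nonneg _
  have hTsq : T ^ 2 = (βm * ‖χ.2‖) ^ 2 + (βs * ‖χ.1‖) ^ 2 := Real.sq_sqrt (by positivity)
  have h4 : T ≤ R := by
    rcases hT0.eq_or_lt with h0 | h0
    · rwa [← h0]
    · exact le_of_mul_le_mul_right (by linarith) h0
  refine le_trans (le_of_sq_le_sq ?_ hT0) h4
  rw [hTsq, mul_pow, norm0_sq, mul_add, mul_pow, mul_pow, add_comm]
  have := lt_min hs hm
  gcongr
  · exact min_le_right _ _
  · exact min_le_left _ _

/-! ### The discrete problem as a coupled saddle point problem -/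

/-- The divergence of the current is itself an admissible test potential, and testing with it gives
−κ‖∇ · J‖² = 0. -/
lemma FESpaces.ChargeConservative.divOf_eq_zero {F : FESpaces Ω} (hF : F.ChargeConservative)
    {P : Data Ω} (hκ : 0 < P.kappa) {η : VelCur Ω} (hη : η ∈ F.D)
    (h : ∀ χ ∈ F.G, P.Bform χ η = 0) : divOf η.2 = 0 := by
  obtain ⟨ψ, hψ, hdiv⟩ := hF η.2 hη.2
  have h1 : P.bs 0 η.1 + P.bm ψ η.2 = 0 := h (0, ψ) ⟨F.E.zero_mem, hψ⟩
  have h2 : P.bs 0 η.1 = 0 := LinearMap.map_zero₂ P.bsL η.1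
  have h3 : P.bm ψ η.2 = -P.kappa * ‖divOf η.2‖ ^ 2 := by
    rw [Data.bm, hdiv, real_inner_self_eq_norm_sq]
  rw [h2, zero_add, h3] at h1
  refine norm_eq_zero.1 (pow_eq_zero_iff two_ne_zero |>.1 ((mul_eq_zero.1 h1).resolve_left ?_))
  exact neg_ne_zero.2 hκ.ne'

/-- The discrete problem in the abstract setting. -/
def FESpaces.saddle (hd : d = 2 ∨ d = 3) (h : IsEmbeddingConstants Ω l₁ l₂ C) (P : Data Ω)
    (hPr : 0 < P.Pr) (hRa : 0 ≤ P.Ra) (hκ : 0 < P.kappa) (hn : ‖P.dir‖ = 1) (F : FESpaces Ω)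
    (hF : F.ChargeConservative) {βs βm : ℝ} (hβs : 0 < βs) (hβm : 0 < βm)
    (hI : F.InfSup P βs βm) : CoupledSaddle F.D F.G F.Z where
  a₀ := (P.A0L hd h).compl₁₂ F.D.subtype F.D.subtype
  a₁ := IsLinearMap.mk₃ (fun x y z : F.D => A1L h x y z)
    (fun y z => ⟨fun _ _ => by simp, fun _ _ => by simp⟩)
    (fun x z => ⟨fun _ _ => by simp, fun _ _ => by simp⟩)
    (fun x y => ⟨fun _ _ => by simp, fun _ _ => by simp⟩)
  b := P.BformL.compl₁₂ F.G.subtype F.D.subtype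
  q := (P.QL h hn).compl₁₂ F.Z.subtype F.D.subtype
  e := (innerₗ (L2 Ω (Pt d))).compl₁₂ (gradL Ω ∘ₗ F.Z.subtype) (gradL Ω ∘ₗ F.Z.subtype)
  h := IsLinearMap.mk₃ (fun (x : F.D) (y z : F.Z) => HformL h x y z)
    (fun y z => ⟨fun _ _ => by simp, fun _ _ => by simp⟩)
    (fun x z => ⟨fun _ _ => by simp, fun _ _ => by simp⟩)
    (fun x y => ⟨fun _ _ => by simp, fun _ _ => by simp⟩)
  L := P.loadL ∘ₗ F.D.subtype
  Ψ := P.heat.toLinearMap ∘ₗ F.Z.subtype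
  nD := (norm1Semi Ω).comp F.D.subtype
  nZ := (normSeminorm ℝ _).comp (gradL Ω ∘ₗ F.Z.subtype)
  nG := fun χ => norm0 (χ : PrePot Ω)
  eq_zero_of_nD x hx := Subtype.ext (h.eq_zero_of_norm1 hx)
  eq_zero_of_nZ x hx := Subtype.ext (h.eq_zero_of_gradOf hx)
  eq_zero_of_nG x hx := Subtype.ext (eq_zero_of_norm0 hx)
  cmin := P.Cmin
  cmax := P.Cmax l₁
  ell := P.normL
  lq := P.lamQ C
  l₂ := l₂
  lam := P.lamHeat
  β := min βs βm
  cmin_pos := P.Cmin_pos hPr hκ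
  cmax_nonneg := P.Cmax_nonneg hPr l₁
  ell_nonneg := Real.sqrt_nonneg _
  lq_nonneg := mul_nonneg (mul_nonneg hPr.le hRa) (sq_nonneg C)
  l₂_nonneg := h.pos₂.le
  lam_nonneg := h.dualNorm_nonneg _
  β_pos := lt_min hβs hβm
  coercive x hx :=
    (P.A0_coercive hd h (hF.divOf_eq_zero hκ x.2 fun χ hχ => hx ⟨χ, hχ⟩)).trans_eq
      (P.A0L_apply hd h x x).symm
  a₀_le x y := (congrArg abs (P.A0L_apply hd h x y)).trans_le (P.abs_A0_le hd h hPr hκ x y)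
  a₁_le x y z := abs_A1_le h x y z
  a₁_self x y := sub_self _
  q_le θ y := P.abs_Q_le h hn hPr hRa θ y
  e_self θ := real_inner_self_eq_norm_sq (gradL Ω θ)
  h_le x θ r := abs_Hform_le h x θ r
  h_self x θ := sub_self _
  L_le y := P.load_le h hκ y
  Ψ_le r := h.le_dualNorm_mul P.heat r
  infsup χ R hR hB := hI.min_mul_norm0_le h hβs hβm χ.2 hR fun Φ hΦ => hB ⟨Φ, hΦ⟩

end ThermalMHD

end

/-! ### Transfer to the discrete problem -/

noncomputable section

namespace ThermalMHD

variable {d : ℕ} {Ω : Set (Pt d)} {l₁ l₂ C : ℝ}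

namespace FESpaces

/-- The state with given components in the discrete spaces. -/
def toState (F : FESpaces Ω) (w : F.D × F.G × F.Z) : State Ω := ⟨w.1, w.2.1, w.2.2⟩

lemma Contains.exists_toState {F : FESpaces Ω} {W : State Ω} (hW : F.Contains W) :
    ∃ w, F.toState w = W :=
  ⟨(⟨W.η, hW.1⟩, ⟨W.ξ, hW.2.1⟩, ⟨W.θ, hW.2.2⟩), rfl⟩

lemma contains_toState (F : FESpaces Ω) (w : F.D × F.G × F.Z) : F.Contains (F.toState w) :=
  ⟨w.1.2, w.2.1.2, w.2.2.2⟩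

section

variable (hd : d = 2 ∨ d = 3) (h : IsEmbeddingConstants Ω l₁ l₂ C) (P : Data Ω)
    (hPr : 0 < P.Pr) (hRa : 0 ≤ P.Ra) (hκ : 0 < P.kappa) (hn : ‖P.dir‖ = 1) (F : FESpaces Ω)
    (hF : F.ChargeConservative) {βs βm : ℝ} (hβs : 0 < βs) (hβm : 0 < βm)
    (hI : F.InfSup P βs βm)

lemma isStokesStep_toState (p w : F.D × F.G × F.Z) :
    F.IsStokesStep P (F.toState p) (F.toState w) ↔
      (F.saddle hd h P hPr hRa hκ hn hF hβs hβm hI).IsStep p w := by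
  let S := F.saddle hd h P hPr hRa hκ hn hF hβs hβm hI
  have hm : ∀ y : F.D, (S.a₀ w.1 y + S.a₁ p.1 p.1 y + S.b w.2.1 y + S.q w.2.2 y = S.L y) ↔
      P.A0 w.1 y + A1 (Ω := Ω) p.1 p.1 y + P.Bform w.2.1 y + P.Q w.2.2 y = P.load y := fun y => by
    have e0 : S.a₀ w.1 y = P.A0 w.1 y :=
      P.A0L_apply hd h w.1 y
    have e1 : S.a₁ p.1 p.1 y = A1 (Ω := Ω) p.1 p.1 y := rfl
    have e2 : S.b w.2.1 y = P.Bform w.2.1 y := rfl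
    have e3 : S.q w.2.2 y = P.Q w.2.2 y := rfl
    have e4 : S.L y = P.load y := rfl
    have aux : ∀ {a b c e l a' b' c' e' l' : ℝ}, a = a' → b = b' → c = c' → e = e' → l = l' →
        (a + b + c + e = l ↔ a' + b' + c' + e' = l') := by
      rintro _ _ _ _ _ _ _ _ _ _ rfl rfl rfl rfl rfl; rfl
    exact aux e0 e1 e2 e3 e4
  exact ⟨fun H => ⟨fun y => (hm y).2 (H.momentum y y.2), fun χ => H.mass χ χ.2,
      fun r => H.energy r r.2⟩,
    fun H => ⟨F.contains_toState w, fun Φ hΦ => (hm ⟨Φ, hΦ⟩).1 (H.momentum ⟨Φ, hΦ⟩),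
      fun χ hχ => H.mass ⟨χ, hχ⟩, fun r hr => H.energy ⟨r, hr⟩⟩⟩

lemma isSolution_toState (w : F.D × F.G × F.Z) :
    F.IsSolution P (F.toState w) ↔
      (F.saddle hd h P hPr hRa hκ hn hF hβs hβm hI).IsStep w w := by
  rw [← isStokesStep_toState]
  exact ⟨fun H => ⟨H.mem, H.momentum, H.mass, H.energy⟩,
    fun H => ⟨H.mem, H.momentum, H.mass, H.energy⟩⟩

/-- Both convection forms vanish at zero, so the problem without convection is the step from zero.
-/
lemma isInitial_toState (w : F.D × F.G × F.Z) :
    F.IsInitial P (F.toState w) ↔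
      (F.saddle hd h P hPr hRa hκ hn hF hβs hβm hI).IsStep 0 w := by
  have h1 : ∀ Φ : VelCur Ω, A1 (0 : VelCur Ω) 0 Φ = 0 := fun Φ =>
    LinearMap.map_zero₂ (A1L h 0) Φ
  have h2 : ∀ r : H10 Ω, Hform (0 : VelCur Ω) 0 r = 0 := fun r =>
    LinearMap.map_zero₂ (HformL h 0) r
  rw [← isStokesStep_toState]
  refine ⟨fun H => ⟨H.mem, fun Φ hΦ => ?_, H.mass, fun r hr => ?_⟩,
    fun H => ⟨H.mem, fun Φ hΦ => ?_, H.mass, fun r hr => ?_⟩⟩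
  · exact (congrArg (fun t => P.A0 w.1 Φ + t + P.Bform w.2.1 Φ + P.Q w.2.2 Φ) (h1 Φ)).trans
      ((congrArg (fun t => t + P.Bform w.2.1 Φ + P.Q w.2.2 Φ) (add_zero _)).trans
        (H.momentum Φ hΦ))
  · exact (congrArg (fun t => eform w.2.2 r + t) (h2 r)).trans
      ((add_zero _).trans (H.energy r hr))
  · exact ((congrArg (fun t => P.A0 w.1 Φ + t + P.Bform w.2.1 Φ + P.Q w.2.2 Φ) (h1 Φ)).trans
      (congrArg (fun t => t + P.Bform w.2.1 Φ + P.Q w.2.2 Φ) (add_zero _))).symm.trans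
        (H.momentum Φ hΦ)
  · exact ((congrArg (fun t => eform w.2.2 r + t) (h2 r)).trans
      (add_zero _)).symm.trans (H.energy r hr)

/-- Expanding `l₂ * bd * (1 / cmin + 1)` gives the four summands of σ. -/
lemma saddle_sig : (F.saddle hd h P hPr hRa hκ hn hF hβs hβm hI).sig = P.sigma l₂ C := by
  have hC := (P.Cmin_pos hPr hκ).ne'
  have e : (F.saddle hd h P hPr hRa hκ hn hF hβs hβm hI).sig =
    l₂ * ((P.normL + P.lamQ C * P.lamHeat) / P.Cmin) * (1 / P.Cmin + 1) := rfl
  rw [e, Data.sigma]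
  field_simp
  ring

end

instance (F : FESpaces Ω) : FiniteDimensional ℝ F.D :=
  Module.Finite.iff_fg.2 ((Module.Finite.iff_fg.1 F.finX).prod (Module.Finite.iff_fg.1 F.finY))

instance (F : FESpaces Ω) : FiniteDimensional ℝ F.G :=
  Module.Finite.iff_fg.2 ((Module.Finite.iff_fg.1 F.finE).prod (Module.Finite.iff_fg.1 F.finS))

instance (F : FESpaces Ω) : FiniteDimensional ℝ F.Z := F.finZ

/-- Transfer of the results on an abstract problem to the discrete problem. -/
lemma stokesIteration_of_saddle {D G Z : Type*} [AddCommGroup D] [Module ℝ D] [AddCommGroup G]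
    [Module ℝ G] [AddCommGroup Z] [Module ℝ Z] [FiniteDimensional ℝ D] [FiniteDimensional ℝ G]
    [FiniteDimensional ℝ Z] (S : CoupledSaddle D G Z) (hσ : S.sig < 1 / 4) {F : FESpaces Ω}
    {P : Data Ω} (f : D × G × Z → State Ω) (hf : ∀ W, F.Contains W → ∃ w, f w = W)
    (hstep : ∀ p w, F.IsStokesStep P (f p) (f w) ↔ S.IsStep p w)
    (hsol : ∀ w, F.IsSolution P (f w) ↔ S.IsStep w w)
    (hini : ∀ w, F.IsInitial P (f w) ↔ S.IsStep 0 w)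
    (hη : ∀ w, norm1 (f w).η = S.nD w.1) (hθ : ∀ w, ‖gradOf (f w).θ‖ = S.nZ w.2.2)
    (hη' : ∀ v w, norm1 ((f v).η - (f w).η) = S.nD (v.1 - w.1))
    (hθ' : ∀ v w, ‖gradOf ((f v).θ - (f w).θ)‖ = S.nZ (v.2.2 - w.2.2))
    (hξ' : ∀ v w, norm0 ((f v).ξ - (f w).ξ) = S.nG (v.2.1 - w.2.1))
    {b σ lam β c : ℝ} (hb : S.bd = b) (hs : S.sig = σ) (hl : S.lam = lam) (hβ : S.β = β)
    (hc : S.cmax + S.cmin ≤ c) :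
    (∃! W : State Ω, F.IsSolution P W) ∧ (∃! s : ℕ → State Ω, F.IsStokesIteration P s) ∧
    ∀ (W : State Ω) (s : ℕ → State Ω), F.IsSolution P W → F.IsStokesIteration P s → ∀ n : ℕ,
      norm1 (s n).η ≤ 2 * b ∧ ‖gradOf (s n).θ‖ ≤ 2 * lam ∧
      norm1 (W.η - (s n).η) ≤ (3 * σ) ^ n * b ∧
      ‖gradOf (W.θ - (s n).θ)‖ ≤ (3 * σ) ^ n * lam ∧
      β * norm0 (W.ξ - (s n).ξ) ≤ c * (3 * σ) ^ n * b := by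
  subst hb hs hl hβ
  obtain ⟨⟨w, hw, hw'⟩, ⟨t, ⟨ht0, hts⟩, ht'⟩, herr⟩ := S.wellPosed hσ
  -- All iterates lie in the discrete spaces, so the whole sequence lifts to the abstract problem.
  have hf' : ∀ s, F.IsStokesIteration P s → ∃ u : ℕ → D × G × Z, s = fun n => f (u n) := by
    intro s hs
    have hmem : ∀ n, F.Contains (s n) := fun n => by
      cases n with
      | zero => exact hs.initial.mem
      | succ n => exact (hs.step n).mem
    choose u hu using fun n => hf (s n) (hmem n)
    exact ⟨u, funext fun n => (hu n).symm⟩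
  refine ⟨⟨f w, (hsol w).2 hw, fun W hW => ?_⟩,
    ⟨fun n => f (t n), ⟨(hini _).2 ht0, fun n => (hstep _ _).2 (hts n)⟩,
      fun s hs => ?_⟩, fun W s hW hs n => ?_⟩
  · obtain ⟨v, rfl⟩ := hf W hW.mem
    exact congrArg f (hw' v ((hsol v).1 hW))
  · obtain ⟨u, rfl⟩ := hf' s hs
    rw [ht' u ⟨(hini _).1 hs.initial, fun n => (hstep _ _).1 (hs.step n)⟩]
  · obtain ⟨v, rfl⟩ := hf W hW.mem
    obtain ⟨u, rfl⟩ := hf' s hs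
    obtain ⟨e1, e2, e3, e4, e5⟩ := herr v u ((hsol v).1 hW) ((hini _).1 hs.initial)
      (fun n => (hstep _ _).1 (hs.step n)) n
    exact ⟨(hη _).trans_le e1, (hθ _).trans_le e2, (hη' _ _).trans_le e3, (hθ' _ _).trans_le e4,
      (congrArg (S.β * ·) (hξ' _ _)).trans_le (e5 c hc)⟩

end FESpaces

end ThermalMHD

end

/-! ### The theorem -/

open ThermalMHD
theorem theorem4p2 {d : ℕ} (hd : d = 2 ∨ d = 3) (Ω : Set (Pt d)) (hΩ : IsOpen Ω)
    (hbdd : Bornology.IsBounded Ω) :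
    (∃ l₁ l₂ C : ℝ, IsEmbeddingConstants Ω l₁ l₂ C) ∧
    ∀ l₁ l₂ C : ℝ, IsEmbeddingConstants Ω l₁ l₂ C →
    ∀ P : Data Ω, 0 < P.Pr → 0 ≤ P.Ra → 0 < P.kappa → ‖P.dir‖ = 1 →
      (d = 2 → ∀ᵐ x ∂(volume.restrict Ω), P.B x 0 = 0 ∧ P.B x 1 = 0) →
    ∀ F : FESpaces Ω, F.ChargeConservative →
    ∀ βs βm : ℝ, 0 < βs → 0 < βm → F.InfSup P βs βm →
      0 < P.sigma l₂ C → P.sigma l₂ C < 1 / 4 →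
      (∃! W : State Ω, F.IsSolution P W) ∧
      (∃! s : ℕ → State Ω, F.IsStokesIteration P s) ∧
      ∀ (W : State Ω) (s : ℕ → State Ω), F.IsSolution P W → F.IsStokesIteration P s →
      ∀ n : ℕ,
        norm1 (s n).η ≤ 2 * ((P.normL + P.lamQ C * P.lamHeat) / P.Cmin) ∧
        ‖gradOf (s n).θ‖ ≤ 2 * P.lamHeat ∧
        norm1 (W.η - (s n).η) ≤
          (3 * P.sigma l₂ C) ^ n * ((P.normL + P.lamQ C * P.lamHeat) / P.Cmin) ∧
        ‖gradOf (W.θ - (s n).θ)‖ ≤ (3 * P.sigma l₂ C) ^ n * P.lamHeat ∧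
        min βs βm * norm0 (W.ξ - (s n).ξ) ≤
          (P.Cmax l₁ + 2 * P.Cmin) * (3 * P.sigma l₂ C) ^ n *
            ((P.normL + P.lamQ C * P.lamHeat) / P.Cmin) := by
  refine ⟨exists_isEmbeddingConstants hd hbdd, fun l₁ l₂ C h P hPr hRa hκ hn _ F hF βs βm hβs hβm
    hI _ hσ => ?_⟩
  have hsig := FESpaces.saddle_sig hd h P hPr hRa hκ hn F hF hβs hβm hI
  have hC := P.Cmin_pos hPr hκ
  exact FESpaces.stokesIteration_of_saddle
    (F.saddle hd h P hPr hRa hκ hn hF hβs hβm hI) (hsig.trans_lt hσ)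
    F.toState (fun _ hW => hW.exists_toState)
    (FESpaces.isStokesStep_toState hd h P hPr hRa hκ hn F hF hβs hβm hI)
    (FESpaces.isSolution_toState hd h P hPr hRa hκ hn F hF hβs hβm hI)
    (FESpaces.isInitial_toState hd h P hPr hRa hκ hn F hF hβs hβm hI)
    (fun _ => rfl) (fun _ => rfl) (fun _ _ => rfl) (fun _ _ => rfl) (fun _ _ => rfl)
    rfl hsig rfl rfl
    -- The abstract estimate has the smaller constant `Cmax + Cmin`.
    (show P.Cmax l₁ + P.Cmin ≤ P.Cmax l₁ + 2 * P.Cmin by linarith)
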